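/- Let $m\ge 1$ and let $\Pi$ be a Lévy measure on $\mathbb R^m$ (that is, $\Pi(\{0\})=0$ and $\int(1\wedge\|u\|^2)\,\Pi(du)<\infty$) such that $\int_{\|u\|>1}\|u\|^p\,\Pi(du)<\infty$ for every $p<\infty$. Let $U$ be a càdlàg Lévy process in $\mathbb R^m$ with Lévy measure $\Pi$ and without Gaussian part and drift, i.e. with independent increments and $$E\,e^{i(\xi,U_t-U_s)}=\exp\Big\{(t-s)\int_{\mathbb R^m}\big(e^{i(u,\xi)}-1-i(u,\xi)\mathbf 1_{\|u\|\le 1}\big)\Pi(du)\Big\},\qquad 0\le s\le t,\ \xi\in\mathbb R^m .$$ Let $a:\mathbb R^m\to\mathbb R^m$ be infinitely differentiable with bounded derivatives of every order $\ge1$, and for $x\in\mathbb R^m$ let $X(x,\cdot)$ be the solution of $$X(x,t)=x+\int_0^t a(X(x,s))\,ds+U_t-U_0,\qquad t\ge 0 .$$ Define the lower order index of $\Pi$ by $$\vartheta=\liminf_{\varepsilon\to0+}\Big[\varepsilon^2\ln\tfrac1\varepsilon\Big]^{-1}\sup_{\|v\|=1}\int_{\mathbb R^m}\big(|(u,v)|\wedge\varepsilon\big)^2\,\Pi(du)\in[0,\infty].$$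 Let $x\in\mathbb R^m$ and $t>0$ be such that the law of $X(x,t)$ has a density $p_{x,t}$ with respect to Lebesgue measure. If $\int_{\|u\|\le1}\|u\|\,\Pi(du)<\infty$, then: (a) $p_{x,t}\notin L_{r,loc}(\mathbb R^m)$ for every real $r>1$ with $t\vartheta<m(1-\frac1r)$; (b) if $t\vartheta<m$, then $p_{x,t}\notin C(\mathbb R^m)$, i.e. $p_{x,t}$ has no continuous version. Without the assumption $\int_{\|u\|\le1}\|u\|\,\Pi(du)<\infty$ one has: (a1) $p_{x,t}\notin L_r(\mathbb R^m)$ for every real $r>1$ with $t\vartheta<m(1-\frac1r)$; (b1) if $t\vartheta<m$, then $p_{x,t}\notin L_\infty(\mathbb R^m)$, i.e. $p_{x,t}$ is not essentially bounded. -/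

import Mathlib

open MeasureTheory ProbabilityTheory Filter Topology Set
open scoped NNReal ENNReal RealInnerProductSpace

noncomputable section

namespace LevySDE

/-- `ℝᵐ` with its Euclidean norm and inner product. -/
abbrev Space (m : ℕ) : Type := EuclideanSpace ℝ (Fin m)

/-- A Lévy measure: no mass at the origin and `∫ min(1, ‖u‖²) Π(du) < ∞`. -/
structure IsLevyMeasure {m : ℕ} (Pi : Measure (Space m)) : Prop where
  zero : Pi {0} = 0
  lintegral_lt_top : ∫⁻ u, ENNReal.ofReal (min 1 (‖u‖ ^ 2)) ∂Pi < ∞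

/-- The Lévy-Khinchin exponent with Lévy measure `Π`, zero Gaussian part and zero drift:
`ψ(ξ) = ∫ (e^{i(u,ξ)} - 1 - i (u,ξ) 1_{‖u‖ ≤ 1}) Π(du)`. -/
def levyExponent {m : ℕ} (Pi : Measure (Space m)) (ξ : Space m) : ℂ :=
  ∫ u, (Complex.exp ((⟪u, ξ⟫ : ℝ) * Complex.I) - 1
    - (Metric.closedBall (0 : Space m) 1).indicator
        (fun u : Space m => ((⟪u, ξ⟫ : ℝ) : ℂ) * Complex.I) u) ∂Pi

/-- A path on `[0, ∞)` that is right continuous with (finite) left limits. -/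
def IsCadlag {m : ℕ} (f : ℝ≥0 → Space m) : Prop :=
  ∀ t, ContinuousWithinAt f (Ici t) t ∧ ∃ l, Tendsto f (𝓝[<] t) (𝓝 l)

/-- `U` is a Lévy process, with arbitrary starting value `U₀`, with Lévy measure `Π`, no Gaussian
part and no drift, that is, `U_t = U_0 + ∫₀ᵗ∫_{‖u‖>1} u ν(ds,du) + ∫₀ᵗ∫_{‖u‖≤1} u ν̃(ds,du)`
for the (compensated) jump measure of `U`. Stationarity of the increments is part of the formula
for their characteristic functions. -/
structure IsLevyProcess {m : ℕ} {Ω : Type*} [MeasurableSpace Ω] (Pi : Measure (Space m))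
    (U : ℝ≥0 → Ω → Space m) (P : Measure Ω) : Prop where
  measurable : ∀ t, Measurable (U t)
  cadlag : ∀ᵐ ω ∂P, IsCadlag (fun t => U t ω)
  indep : HasIndepIncrements U P
  charFun_increment : ∀ s t : ℝ≥0, s ≤ t → ∀ ξ : Space m,
    charFun (P.map (U t - U s)) ξ = Complex.exp ((((t : ℝ) - (s : ℝ) : ℝ) : ℂ) * levyExponent Pi ξ)

/-- `X` is the solution of `X(t) = x + ∫₀ᵗ a(X(s)) ds + U_t - U_0`, `t ≥ 0`. -/
structure IsSolution {m : ℕ} {Ω : Type*} [MeasurableSpace Ω] (a : Space m → Space m) (x : Space m)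
    (U X : ℝ≥0 → Ω → Space m) (P : Measure Ω) : Prop where
  measurable : ∀ t, Measurable (X t)
  cadlag : ∀ᵐ ω ∂P, IsCadlag (fun t => X t ω)
  eqn : ∀ᵐ ω ∂P, ∀ t : ℝ≥0,
    X t ω = x + (∫ s in (0 : ℝ)..(t : ℝ), a (X s.toNNReal ω)) + U t ω - U 0 ω

/-- `a` is infinitely differentiable and all its derivatives (of order at least one) are bounded. -/
def SmoothBoundedDerivatives {m : ℕ} (a : Space m → Space m) : Prop :=
  ContDiff ℝ ((⊤ : ℕ∞) : WithTop ℕ∞) a ∧ ∀ k : ℕ, 1 ≤ k → ∃ C : ℝ, ∀ x, ‖iteratedFDeriv ℝ k a x‖ ≤ C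

/-- `∫_{‖u‖>1} ‖u‖ᵖ Π(du) < ∞` for every finite `p`. -/
def LargeJumpMoments {m : ℕ} (Pi : Measure (Space m)) : Prop :=
  ∀ p : ℝ, 0 < p → ∫⁻ u in {u : Space m | 1 < ‖u‖}, ENNReal.ofReal (‖u‖ ^ p) ∂Pi < ∞

/-- `∫_{‖u‖≤1} ‖u‖ Π(du) < ∞`. -/
def SmallJumpMoment {m : ℕ} (Pi : Measure (Space m)) : Prop :=
  ∫⁻ u in {u : Space m | ‖u‖ ≤ 1}, ENNReal.ofReal ‖u‖ ∂Pi < ∞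

/-- `ϑ(ε) = [ε² ln(1/ε)]⁻¹ sup_{‖v‖=1} ∫ (|(u,v)| ∧ ε)² Π(du)`; only `0 < ε < 1` matters. -/
def lowerOrderFun {m : ℕ} (Pi : Measure (Space m)) (ε : ℝ) : ℝ≥0∞ :=
  (ENNReal.ofReal (ε ^ 2 * Real.log (1 / ε)))⁻¹ *
    ⨆ v ∈ Metric.sphere (0 : Space m) 1, ∫⁻ u, ENNReal.ofReal ((min |⟪u, v⟫| ε) ^ 2) ∂Pi

/-- The lower order index `ϑ = liminf_{ε → 0+} ϑ(ε) ∈ [0, ∞]`. -/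
def lowerOrderIndex {m : ℕ} (Pi : Measure (Space m)) : ℝ≥0∞ :=
  liminf (lowerOrderFun Pi) (𝓝[>] (0 : ℝ))

/-- `μ(dy) = p(y) dy`. -/
structure IsDensity {m : ℕ} (μ : Measure (Space m)) (p : Space m → ℝ) : Prop where
  measurable : Measurable p
  nonneg : ∀ y, 0 ≤ p y
  eq_withDensity : μ = volume.withDensity (fun y => ENNReal.ofReal (p y))

/-- The class `L_{r,loc}(ℝᵐ)`: the restriction to every compact set is in `L_r`. -/
def MemLpLoc {m : ℕ} (p : Space m → ℝ) (r : ℝ≥0∞) : Prop :=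
  ∀ K : Set (Space m), IsCompact K → MemLp p r (volume.restrict K)

end LevySDE

end

/-! The law of `X t` charges some very small balls more than an `L_q` density permits. Put `β = 1 -
1/q` and choose `tϑ < α < κmβ` with `κ < 1`. If balls of radius `Cε^κ` have mass at least `ε^α / 2`
for arbitrarily small `ε`, Hölder's inequality, which bounds such a mass by a constant times `‖p‖_q
ε^(κmβ)`, is violated.

The balls arise as follows. Fix `η` comparable to `ε`. With probability `exp(-t Π{‖u‖ > η})` there
is no jump larger than `η`, and then the compensated small jumps, of variance `t ∫_{‖u‖≤η} ‖u‖²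
Π(du)`, stay within `ρ = ε^κ` by a Kolmogorov-type inequality. Two driving paths of this kind differ
by at most `2ρ`, so by Gronwall the solutions differ at time `t` by at most `2ρ exp(Lt)`: the
solution along any single good path is a centre (`IsSolution.exists_smallBall`). The centre involves
the drift left by the compensation, which is bounded in `η` when `∫_{‖u‖≤1} ‖u‖ Π(du) < ∞`; this
separates the local statements from the global ones.

The index controls only one-dimensional projections, while the exponent `α` is sharp, so the tail of
`Π` has to be bounded with a constant close to one. Averaging over directions does this
(`IsLevyMeasure.tail_le`), at the cost of taking `η = ε/r` instead of `ε`. The variance tolerates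
any constant, because `ε^(2-2κ) ln(1/ε)` tends to zero.

The jump structure of `U` is never decomposed. Its increments on a grid are i.i.d. with a known
characteristic function, so their law is a weak limit of convolutions of elementary steps, for which
the estimate is explicit; closed sets preserve the lower bound in the limit
(`IsLevyMeasure.le_pi_stayWithin`). Dyadic grids and right continuity then give whole paths
(`IsLevyProcess.exists_smallBall`). -/

noncomputable section

set_option linter.unusedSectionVars false

namespace LevySDE

/-! ### Random walks confined to a ball. -/

section RandomWalk

variable {E : Type*} [NormedAddCommGroup E] [InnerProductSpace ℝ E] [FiniteDimensional ℝ E]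
  [MeasurableSpace E] [BorelSpace E]

/-- The increments of a walk of `K` steps that starts at `x` and stays in the ball of
radius `ρ`. -/
def stayWithin (ρ : ℝ) : (K : ℕ) → E → Set (Fin K → E)
  | 0, x => {_y | ‖x‖ ≤ ρ}
  | K + 1, x => {y | ‖x‖ ≤ ρ ∧ Fin.tail y ∈ stayWithin ρ K (x + y 0)}

/-- Joint closedness in the starting point and the increments serves twice: measurability when
conditioning on the first step, and the portmanteau theorem for the weak limit. -/
lemma isClosed_stayWithin_prod (ρ : ℝ) (K : ℕ) :
    IsClosed {q : E × (Fin K → E) | q.2 ∈ stayWithin ρ K q.1} := by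
  induction K with
  | zero =>
    exact isClosed_le (f := fun q : E × (Fin 0 → E) => ‖q.1‖) (by fun_prop) continuous_const
  | succ K ih =>
    refine (isClosed_le (f := fun q : E × (Fin (K + 1) → E) => ‖q.1‖) (by fun_prop)
      continuous_const).inter (ih.preimage
      (f := fun q : E × (Fin (K + 1) → E) => (q.1 + q.2 0, Fin.tail q.2)) ?_)
    refine Continuous.prodMk (by fun_prop) (continuous_pi fun i => ?_)
    exact (continuous_apply _).comp continuous_snd

lemma isClosed_stayWithin (ρ : ℝ) (K : ℕ) (x : E) : IsClosed (stayWithin ρ K x) :=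
  (isClosed_stayWithin_prod ρ K).preimage (f := fun y : Fin K → E => (x, y)) (by fun_prop)

lemma norm_le_of_increments_mem_stayWithin {ρ : ℝ} {K : ℕ} {z : ℕ → E}
    (h : (fun i : Fin K => z (i + 1) - z i) ∈ stayWithin ρ K (z 0)) {k : ℕ} (hk : k ≤ K) :
    ‖z k‖ ≤ ρ := by
  induction K generalizing z k with
  | zero => obtain rfl : k = 0 := by omega
            exact h
  | succ K ih =>
    cases k with
    | zero => exact h.1
    | succ k =>
      refine ih (z := fun i => z (i + 1)) ?_ (by omega : k ≤ K)
      have h2 := h.2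
      simpa [Fin.tail_def] using h2

/-- `μ` has mean zero and second moment at most `v`. -/
structure IsCentered (μ : Measure E) (v : ℝ) : Prop where
  integrable_sq : Integrable (fun x => ‖x‖ ^ 2) μ
  mean : ∫ x, x ∂μ = 0
  moment : ∫ x, ‖x‖ ^ 2 ∂μ ≤ v

lemma integrable_id_of_sq {μ : Measure E} [IsFiniteMeasure μ]
    (h : Integrable (fun x => ‖x‖ ^ 2) μ) : Integrable (fun x : E => x) μ := by
  refine Integrable.mono' (h.add (integrable_const (1 : ℝ))) (by fun_prop) (ae_of_all _ fun x => ?_)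
  simp only [Pi.add_apply]
  nlinarith [sq_nonneg (‖x‖ - 1)]

lemma IsCentered.integrable_add_sq {μ : Measure E} [IsFiniteMeasure μ] {v : ℝ}
    (h : IsCentered μ v) (x : E) : Integrable (fun y => ‖x + y‖ ^ 2) μ := by
  simp_rw [norm_add_sq_real]
  exact ((integrable_const _).add
    (((integrable_id_of_sq h.integrable_sq).const_inner x).const_mul 2)).add h.integrable_sq

lemma IsCentered.integral_add_sq {μ : Measure E} [IsProbabilityMeasure μ] {v : ℝ}
    (h : IsCentered μ v) (x : E) : ∫ y, ‖x + y‖ ^ 2 ∂μ = ‖x‖ ^ 2 + ∫ y, ‖y‖ ^ 2 ∂μ := by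
  have h1 := (integrable_id_of_sq h.integrable_sq)
  have h2 : Integrable (fun y => 2 * ⟪x, y⟫) μ := (h1.const_inner x).const_mul 2
  simp_rw [norm_add_sq_real]
  rw [integral_add (by fun_prop) h.integrable_sq, integral_add (by fun_prop) h2, integral_const_mul,
    integral_inner h1, h.mean]
  simp

lemma ofReal_integral_le_lintegral {α : Type*} [MeasurableSpace α] {μ : Measure α} {f : α → ℝ}
    (hf : Integrable f μ) : ENNReal.ofReal (∫ x, f x ∂μ) ≤ ∫⁻ x, ENNReal.ofReal (f x) ∂μ := by
  have h1 : Integrable (fun x => max (f x) 0) μ := hf.pos_part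
  calc ENNReal.ofReal (∫ x, f x ∂μ) ≤ ENNReal.ofReal (∫ x, max (f x) 0 ∂μ) :=
        ENNReal.ofReal_le_ofReal (integral_mono hf h1 fun x => le_max_left _ _)
    _ = ∫⁻ x, ENNReal.ofReal (max (f x) 0) ∂μ :=
        ofReal_integral_eq_lintegral_ofReal h1 (ae_of_all _ fun x => le_max_right _ _)
    _ = ∫⁻ x, ENNReal.ofReal (f x) ∂μ := by
        refine lintegral_congr fun x => ?_
        rcases le_total (f x) 0 with h | h
        · simp [h]
        · simp [h]

/-- A Kolmogorov-type inequality, for a step distribution that dominates a multiple of a centered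
one. -/
lemma le_pi_stayWithin {θ θ' : Measure E} [IsProbabilityMeasure θ] [IsProbabilityMeasure θ']
    {c : ℝ≥0∞} (hle : c • θ' ≤ θ) {v : ℝ} (hθ' : IsCentered θ' v) {ρ : ℝ} (hρ : 0 < ρ) (K : ℕ)
    (x : E) :
    c ^ K * ENNReal.ofReal (1 - (‖x‖ ^ 2 + K * v) / ρ ^ 2) ≤
      Measure.pi (fun _ : Fin K => θ) (stayWithin ρ K x) := by
  have hv : 0 ≤ v := (integral_nonneg fun x => by positivity).trans hθ'.moment
  induction K generalizing x with
  | zero =>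
    rcases le_or_gt ‖x‖ ρ with h | h
    · have : stayWithin ρ 0 x = univ := by ext; simpa [stayWithin] using h
      rw [this, measure_univ]
      simp only [pow_zero, one_mul, CharP.cast_eq_zero, zero_mul, add_zero]
      rw [← ENNReal.ofReal_one]
      exact ENNReal.ofReal_le_ofReal (by have : 0 ≤ ‖x‖ ^ 2 / ρ ^ 2 := by positivity
                                         linarith)
    · rw [ENNReal.ofReal_of_nonpos, mul_zero]
      · exact zero_le
      · rw [sub_nonpos, one_le_div (by positivity)]
        simp only [CharP.cast_eq_zero, zero_mul, add_zero]
        gcongr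
  | succ K ih =>
    rcases le_or_gt ‖x‖ ρ with h | h
    swap
    · rw [ENNReal.ofReal_of_nonpos, mul_zero]
      · exact zero_le
      · rw [sub_nonpos, one_le_div (by positivity)]
        have : ρ ^ 2 ≤ ‖x‖ ^ 2 := by gcongr
        have : 0 ≤ ((K + 1 : ℕ) : ℝ) * v := by positivity
        linarith
    have hmp := (measurePreserving_piFinSuccAbove (fun _ : Fin (K + 1) => θ) 0).symm
    have hmeas : MeasurableSet {q : E × (Fin K → E) | q.2 ∈ stayWithin ρ K (x + q.1)} :=
      ((isClosed_stayWithin_prod ρ K).preimage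
        (f := fun q : E × (Fin K → E) => (x + q.1, q.2)) (by fun_prop)).measurableSet
    -- Condition on the first step. Since a centered step raises the mean of `‖x‖²` by at most `v`,
    -- the lower bound with `K` steps left, averaged over `θ'`, dominates the one with `K + 1`.
    have hrec : Measure.pi (fun _ : Fin (K + 1) => θ) (stayWithin ρ (K + 1) x) =
        ∫⁻ y, Measure.pi (fun _ : Fin K => θ) (stayWithin ρ K (x + y)) ∂θ := by
      rw [← hmp.measure_preimage (isClosed_stayWithin ρ (K + 1) x).measurableSet.nullMeasurableSet]
      have : (MeasurableEquiv.piFinSuccAbove (fun _ : Fin (K + 1) => E) 0).symm ⁻¹'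
          stayWithin ρ (K + 1) x = {q : E × (Fin K → E) | q.2 ∈ stayWithin ρ K (x + q.1)} := by
        ext q
        simp [stayWithin, h, MeasurableEquiv.piFinSuccAbove_symm_apply, Fin.insertNthEquiv]
      rw [this, Measure.prod_apply hmeas]
      rfl
    have hint : Integrable (fun y => 1 - (‖x + y‖ ^ 2 + K * v) / ρ ^ 2) θ' :=
      (integrable_const _).sub
        (((hθ'.integrable_add_sq x).add (integrable_const _)).div_const _)
    rw [hrec]
    calc c ^ (K + 1) * ENNReal.ofReal (1 - (‖x‖ ^ 2 + (K + 1 : ℕ) * v) / ρ ^ 2)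
        ≤ c ^ (K + 1) * ENNReal.ofReal (∫ y, (1 - (‖x + y‖ ^ 2 + K * v) / ρ ^ 2) ∂θ') := by
          gcongr
          have hsq := hθ'.integrable_add_sq x
          rw [integral_sub (by fun_prop) (by fun_prop), integral_div,
            integral_add hsq (by fun_prop), hθ'.integral_add_sq]
          simp only [integral_const, probReal_univ, smul_eq_mul, one_mul]
          have := hθ'.moment
          refine sub_le_sub_left (div_le_div_of_nonneg_right ?_ (by positivity)) _
          push_cast
          linarith
      _ ≤ c ^ (K + 1) * ∫⁻ y, ENNReal.ofReal (1 - (‖x + y‖ ^ 2 + K * v) / ρ ^ 2) ∂θ' := by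
          gcongr
          exact ofReal_integral_le_lintegral hint
      _ = ∫⁻ y, c ^ K * ENNReal.ofReal (1 - (‖x + y‖ ^ 2 + K * v) / ρ ^ 2) ∂(c • θ') := by
          rw [lintegral_const_mul _ (by fun_prop), lintegral_smul_measure, smul_eq_mul]
          ring
      _ ≤ ∫⁻ y, Measure.pi (fun _ : Fin K => θ) (stayWithin ρ K (x + y)) ∂θ :=
          lintegral_mono' hle fun y => ih (x + y)

end RandomWalk

/-! ### Convolution powers: moments and mass at zero. -/

section ConvolutionPowers

variable {E : Type*} [NormedAddCommGroup E] [InnerProductSpace ℝ E] [FiniteDimensional ℝ E]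
  [MeasurableSpace E] [BorelSpace E]

/-- The `n`-th convolution power of a measure. -/
def convPow (μ : Measure E) : ℕ → Measure E
  | 0 => Measure.dirac 0
  | n + 1 => μ ∗ convPow μ n

instance isProbabilityMeasure_convPow (μ : Measure E) [IsProbabilityMeasure μ] (n : ℕ) :
    IsProbabilityMeasure (convPow μ n) := by
  induction n with
  | zero => rw [convPow]; infer_instance
  | succ n ih => rw [convPow]; infer_instance

lemma charFun_convPow (μ : Measure E) [IsProbabilityMeasure μ] (n : ℕ) (ξ : E) :
    charFun (convPow μ n) ξ = charFun μ ξ ^ n := by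
  induction n with
  | zero => simp [convPow, charFun_dirac]
  | succ n ih => rw [convPow, charFun_conv, ih, pow_succ']

lemma IsCentered.conv {μ ν : Measure E} [IsProbabilityMeasure μ] [IsProbabilityMeasure ν]
    {v w : ℝ} (hμ : IsCentered μ v) (hν : IsCentered ν w) : IsCentered (μ ∗ ν) (v + w) := by
  have hi : Integrable (fun x => ‖x‖ ^ 2) (μ ∗ ν) := by
    rw [integrable_conv_iff (by fun_prop)]
    refine ⟨ae_of_all _ fun x => hν.integrable_add_sq x, ?_⟩
    simp only [norm_pow, norm_norm]
    simp_rw [hν.integral_add_sq]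
    exact hμ.integrable_sq.add (integrable_const _)
  refine ⟨hi, ?_, ?_⟩
  · have hμ1 := integrable_id_of_sq hμ.integrable_sq
    have hν1 := integrable_id_of_sq hν.integrable_sq
    rw [integral_conv (integrable_id_of_sq hi)]
    have : ∀ x : E, ∫ y, (x + y) ∂ν = x := fun x => by
      rw [integral_add (by fun_prop) hν1, hν.mean]; simp
    simp_rw [this]
    exact hμ.mean
  · rw [integral_conv hi]
    simp_rw [hν.integral_add_sq]
    rw [integral_add hμ.integrable_sq (by fun_prop)]
    simpa using add_le_add hμ.moment hν.moment

lemma IsCentered.convPow {μ : Measure E} [IsProbabilityMeasure μ] {v : ℝ} (hμ : IsCentered μ v)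
    (n : ℕ) : IsCentered (convPow μ n) (n * v) := by
  induction n with
  | zero =>
    refine ⟨integrable_dirac (by simp), ?_, ?_⟩ <;> simp [LevySDE.convPow]
  | succ n ih =>
    have := hμ.conv ih
    rw [LevySDE.convPow]
    convert this using 1
    push_cast; ring

lemma conv_mono {μ μ' ν ν' : Measure E} [SFinite ν'] (h1 : μ ≤ μ') (h2 : ν ≤ ν') :
    μ ∗ ν ≤ μ' ∗ ν' :=
  Measure.map_mono (Measure.prod_mono h1 h2) (by fun_prop)

lemma smul_dirac_le_convPow {μ : Measure E} [IsProbabilityMeasure μ] {c : ℝ≥0∞}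
    (h : c • Measure.dirac 0 ≤ μ) (n : ℕ) : c ^ n • Measure.dirac 0 ≤ convPow μ n := by
  induction n with
  | zero => simp [convPow]
  | succ n ih =>
    calc c ^ (n + 1) • Measure.dirac (0 : E)
        = (c • Measure.dirac 0) ∗ (c ^ n • Measure.dirac 0) := by
          rw [Measure.conv_smul_left, Measure.dirac_zero_conv, smul_smul, pow_succ']
      _ ≤ μ ∗ convPow μ n := conv_mono h ih

end ConvolutionPowers

/-! ### Elementary steps carrying at most one jump. -/

section BernoulliStep

variable {E : Type*} [NormedAddCommGroup E] [InnerProductSpace ℝ E] [FiniteDimensional ℝ E]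
  [MeasurableSpace E] [BorelSpace E]

/-- The law of a step that is zero with probability `1 - q ν(E)` and is distributed as `q ν`
otherwise. -/
def bernoulliStep (ν : Measure E) (q : ℝ) : Measure E :=
  ENNReal.ofReal (1 - q * ν.real univ) • Measure.dirac 0 + ENNReal.ofReal q • ν

variable {ν : Measure E} [IsFiniteMeasure ν] {q : ℝ}

lemma isProbabilityMeasure_bernoulliStep (hq : 0 ≤ q) (h : q * ν.real univ ≤ 1) :
    IsProbabilityMeasure (bernoulliStep ν q) := by
  constructor
  simp only [bernoulliStep, Measure.coe_add, Measure.coe_smul, Pi.add_apply, Pi.smul_apply,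
    measure_univ, smul_eq_mul, mul_one]
  rw [← ofReal_measureReal (μ := ν), ← ENNReal.ofReal_mul hq,
    ← ENNReal.ofReal_add (by linarith) (by positivity)]
  simp

lemma smul_dirac_le_bernoulliStep :
    ENNReal.ofReal (1 - q * ν.real univ) • Measure.dirac 0 ≤ bernoulliStep ν q :=
  Measure.le_add_right le_rfl

lemma integrable_bernoulliStep {F : Type*} [NormedAddCommGroup F] {f : E → F}
    (hf : Integrable f ν) : Integrable f (bernoulliStep ν q) := by
  refine Integrable.add_measure ?_ ?_
  · exact (integrable_dirac (by simp)).smul_measure (by simp)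
  · exact hf.smul_measure (by simp)

lemma integral_bernoulliStep {F : Type*} [NormedAddCommGroup F] [NormedSpace ℝ F] [CompleteSpace F]
    {f : E → F} (hf : Integrable f ν) (hq : 0 ≤ q) (h : q * ν.real univ ≤ 1) :
    ∫ x, f x ∂(bernoulliStep ν q) = (1 - q * ν.real univ) • f 0 + q • ∫ x, f x ∂ν := by
  rw [bernoulliStep, integral_add_measure ((integrable_dirac (by simp)).smul_measure (by simp))
    (hf.smul_measure (by simp)), integral_smul_measure, integral_smul_measure, integral_dirac,
    ENNReal.toReal_ofReal (by linarith), ENNReal.toReal_ofReal hq]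

lemma integrable_exp_inner (ν : Measure E) [IsFiniteMeasure ν] (ξ : E) :
    Integrable (fun u : E => Complex.exp ((⟪u, ξ⟫ : ℝ) * Complex.I)) ν := by
  refine Integrable.of_bound (C := 1) (by fun_prop) (ae_of_all _ fun u => ?_)
  rw [Complex.norm_exp_ofReal_mul_I]

lemma charFun_bernoulliStep (hq : 0 ≤ q) (h : q * ν.real univ ≤ 1) (ξ : E) :
    charFun (bernoulliStep ν q) ξ =
      1 + q * ∫ u, (Complex.exp ((⟪u, ξ⟫ : ℝ) * Complex.I) - 1) ∂ν := by
  rw [charFun_apply, integral_bernoulliStep (integrable_exp_inner ν ξ) hq h,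
    integral_sub (integrable_exp_inner ν ξ) (by fun_prop)]
  simp
  ring

/-- The compensated step. -/
def compensatedStep (ν : Measure E) (q : ℝ) : Measure E :=
  (bernoulliStep ν q).map (fun x => x + -(q • ∫ u, u ∂ν))

lemma isProbabilityMeasure_compensatedStep (hq : 0 ≤ q) (h : q * ν.real univ ≤ 1) :
    IsProbabilityMeasure (compensatedStep ν q) := by
  have := isProbabilityMeasure_bernoulliStep hq h
  exact Measure.isProbabilityMeasure_map (by fun_prop)

lemma charFun_compensatedStep (hq : 0 ≤ q) (h : q * ν.real univ ≤ 1) (ξ : E) :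
    charFun (compensatedStep ν q) ξ =
      Complex.exp (-((q * ⟪∫ u, u ∂ν, ξ⟫ : ℝ) * Complex.I)) *
      (1 + q * ∫ u, (Complex.exp ((⟪u, ξ⟫ : ℝ) * Complex.I) - 1) ∂ν) := by
  rw [compensatedStep, charFun_map_add_const, charFun_bernoulliStep hq h, mul_comm]
  congr 2
  simp [inner_neg_left, real_inner_smul_right, real_inner_comm]

/-- The variance is the second moment minus the squared mean `‖q • M‖²`, which is discarded. -/
lemma isCentered_compensatedStep (hν : Integrable (fun u => ‖u‖ ^ 2) ν) (hq : 0 ≤ q)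
    (h : q * ν.real univ ≤ 1) :
    IsCentered (compensatedStep ν q) (q * ∫ u, ‖u‖ ^ 2 ∂ν) := by
  have hprob := isProbabilityMeasure_bernoulliStep hq h
  have hν1 := integrable_id_of_sq hν
  have hi2 := integrable_bernoulliStep (q := q) hν
  have hi1 := integrable_bernoulliStep (q := q) hν1
  set M := ∫ u, u ∂ν with hM
  have hmean : ∫ x, x ∂(bernoulliStep ν q) = q • M := by
    rw [integral_bernoulliStep hν1 hq h]; simp [hM]
  have hsq : ∀ x : E, ‖x + -(q • M)‖ ^ 2 = ‖x‖ ^ 2 - 2 * ⟪q • M, x⟫ + ‖q • M‖ ^ 2 := fun x => by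
    rw [← sub_eq_add_neg, norm_sub_sq_real, real_inner_comm]
  have hin : Integrable (fun x => 2 * ⟪q • M, x⟫) (bernoulliStep ν q) :=
    (hi1.const_inner _).const_mul 2
  refine ⟨?_, ?_, ?_⟩
  · rw [compensatedStep, integrable_map_measure (by fun_prop) (by fun_prop)]
    simp only [Function.comp_def, ← hM, hsq]
    exact (hi2.sub hin).add (integrable_const _)
  · rw [compensatedStep, integral_map (by fun_prop) (by fun_prop), integral_add hi1 (by fun_prop),
      hmean]
    simp [hM]
  · rw [compensatedStep, integral_map (by fun_prop) (by fun_prop)]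
    simp only [← hM, hsq]
    have hd : Integrable (fun x => ‖x‖ ^ 2 - 2 * ⟪q • M, x⟫) (bernoulliStep ν q) := hi2.sub hin
    rw [integral_add hd (by fun_prop), integral_sub hi2 hin, integral_const_mul,
      integral_inner hi1, hmean, integral_bernoulliStep hν hq h]
    simp only [norm_zero, smul_eq_mul, integral_const, probReal_univ, real_inner_self_eq_norm_sq]
    nlinarith [sq_nonneg ‖q • M‖]

end BernoulliStep

/-! ### The Lévy-Khinchin integrand and its integrability. -/

section Exponent

variable {m : ℕ} {Pi : Measure (Space m)}

/-- The Lévy-Khinchin integrand with compensation of the jumps of size at most `η`. -/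
def jumpIntegrand (η : ℝ) (ξ u : Space m) : ℂ :=
  Complex.exp ((⟪u, ξ⟫ : ℝ) * Complex.I) - 1
    - (Metric.closedBall (0 : Space m) η).indicator
        (fun u : Space m => ((⟪u, ξ⟫ : ℝ) : ℂ) * Complex.I) u

lemma norm_exp_mul_I_sub_one_le (x : ℝ) : ‖Complex.exp (x * Complex.I) - 1‖ ≤ |x| := by
  have := Real.norm_exp_I_mul_ofReal_sub_one_le (x := x)
  rwa [mul_comm] at this

lemma norm_exp_mul_I_sub_one_le_two (x : ℝ) : ‖Complex.exp (x * Complex.I) - 1‖ ≤ 2 := by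
  refine (norm_sub_le _ _).trans ?_
  rw [Complex.norm_exp_ofReal_mul_I]
  norm_num

lemma norm_exp_mul_I_sub_one_sub_le (x : ℝ) :
    ‖Complex.exp (x * Complex.I) - 1 - x * Complex.I‖ ≤ 2 * x ^ 2 := by
  have hn : ‖(x : ℂ) * Complex.I‖ = |x| := by simp
  rcases le_or_gt |x| 1 with h | h
  · have := Complex.norm_exp_sub_one_sub_id_le (x := x * Complex.I) (by rwa [hn])
    rw [hn, sq_abs] at this
    nlinarith [sq_nonneg x]
  · have := norm_sub_le (Complex.exp (x * Complex.I) - 1) (x * Complex.I)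
    rw [hn] at this
    have h2 := norm_exp_mul_I_sub_one_le x
    nlinarith [sq_abs x]

lemma measurable_jumpIntegrand (η : ℝ) (ξ : Space m) : Measurable (jumpIntegrand η ξ) := by
  unfold jumpIntegrand
  refine Measurable.sub (by fun_prop) (Measurable.indicator (by fun_prop) measurableSet_closedBall)

lemma jumpIntegrand_of_le {η : ℝ} {u : Space m} (h : ‖u‖ ≤ η) (ξ : Space m) :
    jumpIntegrand η ξ u = Complex.exp ((⟪u, ξ⟫ : ℝ) * Complex.I) - 1
      - ((⟪u, ξ⟫ : ℝ) : ℂ) * Complex.I := by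
  rw [jumpIntegrand, indicator_of_mem (by simpa using h)]

lemma jumpIntegrand_of_lt {η : ℝ} {u : Space m} (h : η < ‖u‖) (ξ : Space m) :
    jumpIntegrand η ξ u = Complex.exp ((⟪u, ξ⟫ : ℝ) * Complex.I) - 1 := by
  rw [jumpIntegrand, indicator_of_notMem (by simpa using h), sub_zero]

lemma norm_jumpIntegrand_le_of_le {η : ℝ} {u : Space m} (h : ‖u‖ ≤ η) (ξ : Space m) :
    ‖jumpIntegrand η ξ u‖ ≤ 2 * ‖ξ‖ ^ 2 * ‖u‖ ^ 2 := by
  rw [jumpIntegrand_of_le h]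
  refine (norm_exp_mul_I_sub_one_sub_le _).trans ?_
  have := abs_real_inner_le_norm u ξ
  have h2 : ⟪u, ξ⟫ ^ 2 ≤ (‖u‖ * ‖ξ‖) ^ 2 := by
    rw [← sq_abs ⟪u, ξ⟫]; gcongr
  nlinarith

lemma IsLevyMeasure.measure_lt_top (hPi : IsLevyMeasure Pi) {η : ℝ} (hη : 0 < η) :
    Pi {u | η < ‖u‖} < ∞ := by
  have hc : 0 < min 1 (η ^ 2) := by positivity
  have h1 : ENNReal.ofReal (min 1 (η ^ 2)) * Pi {u | η < ‖u‖} ≤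
      ∫⁻ u, ENNReal.ofReal (min 1 (‖u‖ ^ 2)) ∂Pi := by
    rw [← setLIntegral_const]
    refine (setLIntegral_mono (by fun_prop) fun u hu => ?_).trans (setLIntegral_le_lintegral _ _)
    exact ENNReal.ofReal_le_ofReal (min_le_min_left _ (by gcongr; exact le_of_lt hu))
  by_contra htop
  rw [not_lt, top_le_iff] at htop
  rw [htop, ENNReal.mul_top (by simpa using hη.ne'), top_le_iff] at h1
  exact hPi.lintegral_lt_top.ne h1

lemma IsLevyMeasure.integrable_min (hPi : IsLevyMeasure Pi) :
    Integrable (fun u => min 1 (‖u‖ ^ 2)) Pi := by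
  refine ⟨by fun_prop, ?_⟩
  rw [hasFiniteIntegral_iff_ofReal (ae_of_all _ fun u => by positivity)]
  exact hPi.lintegral_lt_top

lemma IsLevyMeasure.integrableOn_sq (hPi : IsLevyMeasure Pi) {η : ℝ} (hη : η ≤ 1) :
    IntegrableOn (fun u => ‖u‖ ^ 2) (Metric.closedBall 0 η) Pi := by
  refine hPi.integrable_min.integrableOn.congr_fun (fun u hu => ?_) measurableSet_closedBall
  have hu1 : ‖u‖ ≤ 1 := (by simpa using hu : ‖u‖ ≤ η).trans hη
  exact min_eq_right (by nlinarith [norm_nonneg u])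

lemma compl_closedBall_eq {η : ℝ} : (Metric.closedBall (0 : Space m) η)ᶜ = {u | η < ‖u‖} := by
  ext u; simp

lemma measurableSet_norm_gt {η : ℝ} : MeasurableSet {u : Space m | η < ‖u‖} :=
  compl_closedBall_eq (m := m) ▸ measurableSet_closedBall.compl

lemma IsLevyMeasure.integrableOn_jumpIntegrand_small (hPi : IsLevyMeasure Pi) {η : ℝ}
    (hη : η ≤ 1) (ξ : Space m) :
    IntegrableOn (jumpIntegrand η ξ) (Metric.closedBall 0 η) Pi := by
  refine Integrable.mono' ((hPi.integrableOn_sq hη).const_mul (2 * ‖ξ‖ ^ 2))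
    (measurable_jumpIntegrand η ξ).aestronglyMeasurable ?_
  refine (ae_restrict_mem measurableSet_closedBall).mono fun u hu => ?_
  exact norm_jumpIntegrand_le_of_le (by simpa using hu) ξ

lemma IsLevyMeasure.integrableOn_jumpIntegrand_large (hPi : IsLevyMeasure Pi) {η : ℝ}
    (hη : 0 < η) (ξ : Space m) :
    IntegrableOn (jumpIntegrand η ξ) {u | η < ‖u‖} Pi := by
  have : IsFiniteMeasure (Pi.restrict {u | η < ‖u‖}) :=
    ⟨by simpa using hPi.measure_lt_top hη⟩
  refine Integrable.of_bound (C := 2) (measurable_jumpIntegrand η ξ).aestronglyMeasurable ?_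
  refine (ae_restrict_mem measurableSet_norm_gt).mono fun u hu => ?_
  rw [jumpIntegrand_of_lt hu]
  exact norm_exp_mul_I_sub_one_le_two _

lemma IsLevyMeasure.integrable_jumpIntegrand (hPi : IsLevyMeasure Pi) {η : ℝ} (hη : 0 < η)
    (hη1 : η ≤ 1) (ξ : Space m) : Integrable (jumpIntegrand η ξ) Pi := by
  rw [← integrableOn_univ, ← union_compl_self (Metric.closedBall (0 : Space m) η),
    compl_closedBall_eq]
  exact (hPi.integrableOn_jumpIntegrand_small hη1 ξ).union
    (hPi.integrableOn_jumpIntegrand_large hη ξ)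

lemma IsLevyMeasure.integral_jumpIntegrand (hPi : IsLevyMeasure Pi) {η : ℝ} (hη : 0 < η)
    (hη1 : η ≤ 1) (ξ : Space m) :
    ∫ u, jumpIntegrand η ξ u ∂Pi = ∫ u in Metric.closedBall 0 η, jumpIntegrand η ξ u ∂Pi +
      ∫ u in {u | η < ‖u‖}, (Complex.exp ((⟪u, ξ⟫ : ℝ) * Complex.I) - 1) ∂Pi := by
  rw [← integral_add_compl measurableSet_closedBall (hPi.integrable_jumpIntegrand hη hη1 ξ),
    compl_closedBall_eq]
  congr 1
  exact setIntegral_congr_fun measurableSet_norm_gt fun u hu => jumpIntegrand_of_lt hu ξ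

end Exponent

/-! ### Removing the smallest jumps; first-order expansion of a compensated step. -/

section Approximation

variable {m : ℕ} {Pi : Measure (Space m)}

/-- The Lévy measure of the jumps of size in `(δ, η]`. -/
def annulusMeasure (Pi : Measure (Space m)) (δ η : ℝ) : Measure (Space m) :=
  Pi.restrict (Metric.closedBall 0 η ∩ {u | δ < ‖u‖})

lemma measurableSet_annulus {δ η : ℝ} :
    MeasurableSet (Metric.closedBall (0 : Space m) η ∩ {u | δ < ‖u‖}) :=
  measurableSet_closedBall.inter measurableSet_norm_gt

lemma IsLevyMeasure.isFiniteMeasure_gt (hPi : IsLevyMeasure Pi) {η : ℝ} (hη : 0 < η) :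
    IsFiniteMeasure (Pi.restrict {u | η < ‖u‖}) :=
  ⟨by simpa using hPi.measure_lt_top hη⟩

lemma IsLevyMeasure.isFiniteMeasure_annulus (hPi : IsLevyMeasure Pi) {δ : ℝ} (hδ : 0 < δ) (η : ℝ) :
    IsFiniteMeasure (annulusMeasure Pi δ η) :=
  ⟨by
    rw [annulusMeasure, Measure.restrict_apply_univ]
    exact (measure_mono inter_subset_right).trans_lt (hPi.measure_lt_top hδ)⟩

lemma IsLevyMeasure.integrable_sq_annulus (hPi : IsLevyMeasure Pi) {η : ℝ} (hη : η ≤ 1) (δ : ℝ) :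
    Integrable (fun u => ‖u‖ ^ 2) (annulusMeasure Pi δ η) :=
  (hPi.integrableOn_sq hη).mono_set inter_subset_left

lemma IsLevyMeasure.integral_sq_annulus_le (hPi : IsLevyMeasure Pi) {η : ℝ} (hη : η ≤ 1) (δ : ℝ) :
    ∫ u, ‖u‖ ^ 2 ∂(annulusMeasure Pi δ η) ≤ ∫ u in Metric.closedBall 0 η, ‖u‖ ^ 2 ∂Pi :=
  setIntegral_mono_set (hPi.integrableOn_sq hη) (ae_of_all _ fun u => by positivity)
    (inter_subset_left.eventuallyLE)

lemma IsLevyMeasure.mul_measureReal_annulus_le (hPi : IsLevyMeasure Pi) {η : ℝ} (hη : η ≤ 1) {δ : ℝ}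
    (hδ : 0 < δ) :
    δ ^ 2 * (annulusMeasure Pi δ η).real univ ≤ ∫ u in Metric.closedBall 0 η, ‖u‖ ^ 2 ∂Pi := by
  have := hPi.isFiniteMeasure_annulus hδ η
  refine le_trans ?_ (hPi.integral_sq_annulus_le hη δ)
  calc δ ^ 2 * (annulusMeasure Pi δ η).real univ = ∫ u, δ ^ 2 ∂(annulusMeasure Pi δ η) := by
        simp [mul_comm]
    _ ≤ ∫ u, ‖u‖ ^ 2 ∂(annulusMeasure Pi δ η) := by
        refine integral_mono_ae (by fun_prop) (hPi.integrable_sq_annulus hη δ) ?_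
        refine (ae_restrict_mem measurableSet_annulus).mono fun u hu => ?_
        have : δ < ‖u‖ := hu.2
        dsimp
        gcongr

lemma IsLevyMeasure.tendsto_integral_annulus (hPi : IsLevyMeasure Pi) {η : ℝ} (hη : η ≤ 1)
    (ξ : Space m) {δ : ℕ → ℝ} (hδ : Tendsto δ atTop (𝓝 0)) :
    Tendsto (fun n => ∫ u, jumpIntegrand η ξ u ∂(annulusMeasure Pi (δ n) η)) atTop
      (𝓝 (∫ u in Metric.closedBall 0 η, jumpIntegrand η ξ u ∂Pi)) := by
  have heq : ∀ n, ∫ u, jumpIntegrand η ξ u ∂(annulusMeasure Pi (δ n) η) =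
      ∫ u in Metric.closedBall 0 η, {u | δ n < ‖u‖}.indicator (jumpIntegrand η ξ) u ∂Pi := fun n => by
    rw [setIntegral_indicator measurableSet_norm_gt]; rfl
  simp_rw [heq]
  refine tendsto_integral_of_dominated_convergence (fun u => ‖jumpIntegrand η ξ u‖)
    (fun n => ((measurable_jumpIntegrand η ξ).indicator measurableSet_norm_gt).aestronglyMeasurable)
    (hPi.integrableOn_jumpIntegrand_small hη ξ).norm
    (fun n => ae_of_all _ fun u => norm_indicator_le_norm_self _ _) (ae_of_all _ fun u => ?_)
  rcases eq_or_ne u 0 with rfl | hu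
  · have : jumpIntegrand η ξ 0 = 0 := by
      simp [jumpIntegrand, indicator]
    refine tendsto_const_nhds.congr fun n => ?_
    simp [indicator, this]
  · refine tendsto_const_nhds.congr' ?_
    filter_upwards [hδ.eventually_lt_const (norm_pos_iff.2 hu)] with n hn
    rw [indicator_of_mem (show u ∈ {u | δ n < ‖u‖} from hn)]

/-- To first order in `q`, the step contributes `q (a - iμ)`. The quadratic remainder of the
exponential and the cross term are both `O(q Λ²)` after multiplication by `n`, since `n q = h0`. -/
lemma tendsto_mul_compensated {q μ Λ : ℕ → ℝ} {a : ℕ → ℂ} {A : ℂ} {h0 ξ : ℝ}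
    (hq : ∀ n, 0 < n → n * q n = h0) (hh : 0 ≤ h0) (hq0 : ∀ n, 0 ≤ q n)
    (hΛ : Tendsto (fun n => q n * Λ n ^ 2) atTop (𝓝 0))
    (hμ : ∀ n, |μ n| ≤ ξ * Λ n) (ha : ∀ n, ‖a n‖ ≤ 2 * Λ n)
    (hlim : Tendsto (fun n => a n - μ n * Complex.I) atTop (𝓝 A)) :
    Tendsto (fun n : ℕ => n * (Complex.exp (-((q n * μ n : ℝ) * Complex.I)) * (1 + q n * a n) - 1))
      atTop (𝓝 (h0 * A)) := by
  have hmain : Tendsto (fun n => (h0 : ℂ) * (a n - μ n * Complex.I)) atTop (𝓝 (h0 * A)) :=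
    hlim.const_mul _
  refine tendsto_of_tendsto_of_dist hmain (squeeze_zero' (Eventually.of_forall fun n => dist_nonneg)
    ?_ (by simpa using hΛ.const_mul (2 * h0 * ξ ^ 2 + h0 * ξ * 2)))
  filter_upwards [eventually_gt_atTop 0] with n hn
  have hnq := hq n hn
  set x : ℝ := -(q n * μ n) with hx
  have hxe : Complex.exp (-((q n * μ n : ℝ) * Complex.I)) = Complex.exp (x * Complex.I) := by
    rw [hx]; push_cast; ring_nf
  have hΛ0 : 0 ≤ Λ n := by linarith [(norm_nonneg _).trans (ha n)]
  have hnqC : (h0 : ℂ) = n * q n := by rw [← hnq]; push_cast; ring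
  rw [dist_comm, dist_eq_norm, hxe]
  have hdecomp : (n : ℂ) * (Complex.exp (x * Complex.I) * (1 + q n * a n) - 1)
      - h0 * (a n - μ n * Complex.I) = n * (Complex.exp (x * Complex.I) - 1 - x * Complex.I)
        + h0 * ((Complex.exp (x * Complex.I) - 1) * a n) := by
    rw [hnqC, hx]; push_cast; ring
  rw [hdecomp]
  have h1 := norm_exp_mul_I_sub_one_sub_le x
  have h2 := norm_exp_mul_I_sub_one_le x
  have hμ2 : μ n ^ 2 ≤ ξ ^ 2 * Λ n ^ 2 := by
    rw [← sq_abs, ← mul_pow]; exact pow_le_pow_left₀ (abs_nonneg _) (hμ n) 2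
  have hxabs : |x| ≤ q n * (ξ * Λ n) := by
    rw [hx, abs_neg, abs_mul, abs_of_nonneg (hq0 n)]
    exact mul_le_mul_of_nonneg_left (hμ n) (hq0 n)
  calc _ ≤ n * (2 * x ^ 2) + h0 * (|x| * (2 * Λ n)) := by
        refine (norm_add_le _ _).trans (add_le_add ?_ ?_)
        · rw [norm_mul, Complex.norm_natCast]
          gcongr
        · rw [norm_mul, norm_mul, Complex.norm_real, Real.norm_of_nonneg hh]
          gcongr
          exact ha n
    _ ≤ n * (2 * (q n ^ 2 * (ξ ^ 2 * Λ n ^ 2))) + h0 * (q n * (ξ * Λ n) * (2 * Λ n)) := by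
        gcongr
        rw [hx, neg_sq, mul_pow]
        gcongr
    _ = (2 * h0 * ξ ^ 2 + h0 * ξ * 2) * (q n * Λ n ^ 2) := by rw [← hnq]; ring

end Approximation

/-! ### Confinement for infinitely divisible steps, by weak limits. -/

section LimitBound

variable {m : ℕ} {Pi : Measure (Space m)}

/-- Truncation levels that tend to zero slowly. -/
def slowLevel (η : ℝ) (n : ℕ) : ℝ := η / √(√(√(n + 1)))

lemma slowLevel_pos {η : ℝ} (hη : 0 < η) (n : ℕ) : 0 < slowLevel η n := by
  unfold slowLevel; positivity

lemma tendsto_slowLevel (η : ℝ) : Tendsto (slowLevel η) atTop (𝓝 0) := by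
  refine Tendsto.div_atTop tendsto_const_nhds ?_
  refine Real.tendsto_sqrt_atTop.comp (Real.tendsto_sqrt_atTop.comp (Real.tendsto_sqrt_atTop.comp ?_))
  exact tendsto_atTop_add_const_right _ _ tendsto_natCast_atTop_atTop

/-- Chebyshev bounds the mass beyond `δ` by a multiple of `δ⁻²`. The eighth root in `slowLevel`
makes its square `O(√n)`, which is negligible against the factor `1/n` in the expansion error. -/
lemma IsLevyMeasure.sq_measureReal_slow_le (hPi : IsLevyMeasure Pi) {η : ℝ} (hη : 0 < η)
    (hη1 : η ≤ 1) (n : ℕ) :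
    (annulusMeasure Pi (slowLevel η n) η).real univ ^ 2 ≤
      ((∫ u in Metric.closedBall 0 η, ‖u‖ ^ 2 ∂Pi) / η ^ 2) ^ 2 * √(n + 1) := by
  have h := hPi.mul_measureReal_annulus_le hη1 (slowLevel_pos hη n)
  set S := ∫ u in Metric.closedBall (0 : Space m) η, ‖u‖ ^ 2 ∂Pi
  set Λ := (annulusMeasure Pi (slowLevel η n) η).real univ with hΛ
  have hΛ0 : 0 ≤ Λ := measureReal_nonneg
  rw [slowLevel, div_pow, Real.sq_sqrt (by positivity), div_mul_eq_mul_div,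
    div_le_iff₀ (by positivity)] at h
  have h2 : Λ ≤ S / η ^ 2 * √(√(n + 1)) := by
    rw [div_mul_eq_mul_div, le_div_iff₀ (by positivity)]
    linarith
  calc Λ ^ 2 ≤ (S / η ^ 2 * √(√(n + 1))) ^ 2 := by gcongr
    _ = _ := by rw [mul_pow, Real.sq_sqrt (by positivity)]

lemma tendsto_div_mul_sqrt (h : ℝ) : Tendsto (fun n : ℕ => h / n * √(n + 1)) atTop (𝓝 0) := by
  have h1 : Tendsto (fun n : ℕ => √(1 / n + (1 / n) ^ 2) * h) atTop (𝓝 0) := by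
    have h2 : Tendsto (fun n : ℕ => (1 / n : ℝ)) atTop (𝓝 0) := tendsto_one_div_atTop_nhds_zero_nat
    simpa using ((h2.add (h2.pow 2)).sqrt).mul_const h
  refine h1.congr' ?_
  filter_upwards [eventually_gt_atTop 0] with n hn
  have hn' : (0 : ℝ) < n := by exact_mod_cast hn
  have : (1 / n + (1 / n) ^ 2 : ℝ) = (n + 1) / n ^ 2 := by field_simp
  rw [this, Real.sqrt_div (by positivity), Real.sqrt_sq hn'.le]
  ring

lemma IsLevyMeasure.tendsto_mul_slow (hPi : IsLevyMeasure Pi) {η : ℝ} (hη : 0 < η)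
    (hη1 : η ≤ 1) {h : ℝ} (hh : 0 ≤ h) :
    Tendsto (fun n : ℕ => h / n * (annulusMeasure Pi (slowLevel η n) η).real univ ^ 2) atTop
      (𝓝 0) := by
  have := (tendsto_div_mul_sqrt h).const_mul
    (((∫ u in Metric.closedBall (0 : Space m) η, ‖u‖ ^ 2 ∂Pi) / η ^ 2) ^ 2)
  rw [mul_zero] at this
  refine squeeze_zero (fun n => by positivity) (fun n => ?_) this
  calc _ ≤ h / n * (((∫ u in Metric.closedBall 0 η, ‖u‖ ^ 2 ∂Pi) / η ^ 2) ^ 2 * √(n + 1)) := by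
        gcongr
        exact hPi.sq_measureReal_slow_le hη hη1 n
    _ = _ := by ring

/-- The convolution powers of the compensated steps approximate the law with exponent
`h ∫_{‖u‖ ≤ η} (e^{i(u,ξ)} - 1 - i(u,ξ)) Π(du)`. -/
lemma IsLevyMeasure.tendsto_charFun_compensated (hPi : IsLevyMeasure Pi) {η : ℝ} (hη : 0 < η)
    (hη1 : η ≤ 1) {h : ℝ} (hh : 0 ≤ h)
    (hsmall : ∀ᶠ n : ℕ in atTop, h / n * (annulusMeasure Pi (slowLevel η n) η).real univ ≤ 1)
    (ξ : Space m) :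
    Tendsto (fun n : ℕ =>
      charFun (compensatedStep (annulusMeasure Pi (slowLevel η n) η) (h / n)) ξ ^ n) atTop
      (𝓝 (Complex.exp (h * ∫ u in Metric.closedBall 0 η, jumpIntegrand η ξ u ∂Pi))) := by
  have hfin : ∀ n, IsFiniteMeasure (annulusMeasure Pi (slowLevel η n) η) := fun n =>
    hPi.isFiniteMeasure_annulus (slowLevel_pos hη n) η
  have key := tendsto_mul_compensated (h0 := h) (q := fun n => h / n) (ξ := ‖ξ‖)
    (μ := fun n => ⟪∫ u, u ∂(annulusMeasure Pi (slowLevel η n) η), ξ⟫)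
    (Λ := fun n => (annulusMeasure Pi (slowLevel η n) η).real univ)
    (a := fun n => ∫ u, (Complex.exp ((⟪u, ξ⟫ : ℝ) * Complex.I) - 1)
      ∂(annulusMeasure Pi (slowLevel η n) η))
    (A := ∫ u in Metric.closedBall 0 η, jumpIntegrand η ξ u ∂Pi)
    (fun n hn => by field_simp) hh (fun n => by positivity) (hPi.tendsto_mul_slow hη hη1 hh)
    ?_ ?_ ?_
  · have := Complex.tendsto_one_add_pow_exp_of_tendsto key
    refine this.congr' ?_
    filter_upwards [hsmall] with n hn
    rw [charFun_compensatedStep (by positivity) hn]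
    congr 1
    push_cast
    ring
  · intro n
    refine (abs_real_inner_le_norm _ _).trans ?_
    rw [mul_comm]
    gcongr
    have : ‖∫ u, u ∂(annulusMeasure Pi (slowLevel η n) η)‖ ≤
        1 * (annulusMeasure Pi (slowLevel η n) η).real univ := by
      refine norm_integral_le_of_norm_le_const ?_
      refine (ae_restrict_mem measurableSet_annulus).mono fun u hu => ?_
      exact (by simpa using hu.1 : ‖u‖ ≤ η).trans hη1
    simpa using this
  · intro n
    exact norm_integral_le_of_norm_le_const (ae_of_all _ fun u => norm_exp_mul_I_sub_one_le_two _)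
  · refine (hPi.tendsto_integral_annulus hη1 ξ (tendsto_slowLevel η)).congr fun n => ?_
    have hi := integrable_id_of_sq (hPi.integrable_sq_annulus hη1 (slowLevel η n))
    rw [real_inner_comm, ← integral_inner hi, ← integral_complex_ofReal, ← integral_mul_const,
      ← integral_sub]
    · refine integral_congr_ae ?_
      refine (ae_restrict_mem measurableSet_annulus).mono fun u hu => ?_
      dsimp
      rw [jumpIntegrand_of_le (by simpa using hu.1), real_inner_comm]
    · exact (integrable_exp_inner _ ξ).sub (by fun_prop)
    · exact ((hi.const_inner ξ).ofReal).mul_const _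

lemma charFun_bernoulliStep_pow {ν : Measure (Space m)} [IsFiniteMeasure ν] {h : ℝ} (hh : 0 ≤ h)
    (hsmall : ∀ᶠ n : ℕ in atTop, h / n * ν.real univ ≤ 1) (ξ : Space m) :
    Tendsto (fun n : ℕ => charFun (bernoulliStep ν (h / n)) ξ ^ n) atTop
      (𝓝 (Complex.exp (h * ∫ u, (Complex.exp ((⟪u, ξ⟫ : ℝ) * Complex.I) - 1) ∂ν))) := by
  refine (Complex.tendsto_one_add_div_pow_exp _).congr' ?_
  filter_upwards [hsmall] with n hn
  rw [charFun_bernoulliStep (by positivity) hn]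
  congr 1
  push_cast
  ring

/-- A random walk whose steps have the Lévy exponent `h ∫ (e^{i(u,ξ)} - 1 - i(u,ξ) 1_{‖u‖≤η}) Π(du)`
stays in a ball at least with the probability that no jump larger than `η` occurs times the
probability given by Chebyshev's inequality. -/
theorem IsLevyMeasure.le_pi_stayWithin (hPi : IsLevyMeasure Pi) {η : ℝ} (hη : 0 < η)
    (hη1 : η ≤ 1) {h : ℝ} (hh : 0 ≤ h) {μ : Measure (Space m)} [IsProbabilityMeasure μ]
    (hμ : ∀ ξ, charFun μ ξ = Complex.exp (h * ∫ u, jumpIntegrand η ξ u ∂Pi)) {ρ : ℝ} (hρ : 0 < ρ)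
    (K : ℕ) :
    ENNReal.ofReal (Real.exp (-(h * Pi.real {u | η < ‖u‖}))) ^ K *
      ENNReal.ofReal (1 - K * (h * ∫ u in Metric.closedBall 0 η, ‖u‖ ^ 2 ∂Pi) / ρ ^ 2) ≤
    Measure.pi (fun _ : Fin K => μ) (stayWithin ρ K 0) := by
  have hfin : ∀ n, IsFiniteMeasure (annulusMeasure Pi (slowLevel η n) η) := fun n =>
    hPi.isFiniteMeasure_annulus (slowLevel_pos hη n) η
  have hfin2 := hPi.isFiniteMeasure_gt hη
  set S := ∫ u in Metric.closedBall (0 : Space m) η, ‖u‖ ^ 2 ∂Pi with hS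
  set ν := Pi.restrict {u | η < ‖u‖} with hν
  have hνu : ν.real univ = Pi.real {u | η < ‖u‖} := by simp [hν, measureReal_def]
  have hdiv : Tendsto (fun n : ℕ => h / n) atTop (𝓝 0) := tendsto_const_div_atTop_nhds_zero_nat h
  have hs1 : ∀ᶠ n : ℕ in atTop, h / n * (annulusMeasure Pi (slowLevel η n) η).real univ ≤ 1 := by
    have h1 := (hPi.tendsto_mul_slow hη hη1 hh).eventually_lt_const (show (0 : ℝ) < 1 / 2 by norm_num)
    have h2 := hdiv.eventually_lt_const (show (0 : ℝ) < 1 / 2 by norm_num)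
    filter_upwards [h1, h2] with n hn1 hn2
    have : 0 ≤ h / n := by positivity
    nlinarith [sq_nonneg ((annulusMeasure Pi (slowLevel η n) η).real univ - 1)]
  have hs2 : ∀ᶠ n : ℕ in atTop, h / n * ν.real univ ≤ 1 := by
    have h1 := hdiv.mul_const (ν.real univ)
    rw [zero_mul] at h1
    exact (h1.eventually_lt_const one_pos).mono fun n hn => hn.le
  -- Shifting the index by `N` makes every step, not just eventually every step, a probability
  -- measure.
  obtain ⟨N, hN⟩ := eventually_atTop.1 (hs1.and hs2)
  set κ : ℕ → Measure (Space m) := fun n =>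
    compensatedStep (annulusMeasure Pi (slowLevel η (n + N)) η) (h / (n + N : ℕ)) with hκ
  set χ : ℕ → Measure (Space m) := fun n => bernoulliStep ν (h / (n + N : ℕ)) with hχ
  have hκp : ∀ n, IsProbabilityMeasure (κ n) := fun n =>
    isProbabilityMeasure_compensatedStep (by positivity) (hN (n + N) (by omega)).1
  have hχp : ∀ n, IsProbabilityMeasure (χ n) := fun n =>
    isProbabilityMeasure_bernoulliStep (by positivity) (hN (n + N) (by omega)).2
  set θ : ℕ → Measure (Space m) := fun n => convPow (κ n) (n + N) ∗ convPow (χ n) (n + N) with hθ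
  have hθp : ∀ n, IsProbabilityMeasure (θ n) := fun n => by rw [hθ]; infer_instance
  let μP : ProbabilityMeasure (Space m) := ⟨μ, inferInstance⟩
  let θP : ℕ → ProbabilityMeasure (Space m) := fun n => ⟨θ n, hθp n⟩
  have hweak : Tendsto θP atTop (𝓝 μP) := by
    refine ProbabilityMeasure.tendsto_of_tendsto_charFun fun ξ => ?_
    change Tendsto (fun n => charFun (θ n) ξ) atTop (𝓝 (charFun μ ξ))
    rw [hμ, hPi.integral_jumpIntegrand hη hη1, mul_add, Complex.exp_add]
    have h1 := (hPi.tendsto_charFun_compensated hη hη1 hh hs1 ξ).mul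
      (charFun_bernoulliStep_pow hh hs2 ξ)
    refine (h1.comp (tendsto_add_atTop_nat N)).congr fun n => ?_
    change _ = charFun (convPow (κ n) (n + N) ∗ convPow (χ n) (n + N)) ξ
    rw [charFun_conv, charFun_convPow, charFun_convPow]
    rfl
  have hpi : Tendsto (fun n => ProbabilityMeasure.pi (fun _ : Fin K => θP n)) atTop
      (𝓝 (ProbabilityMeasure.pi (fun _ : Fin K => μP))) :=
    (ProbabilityMeasure.continuous_pi.tendsto _).comp (tendsto_pi_nhds.2 fun _ => hweak)
  -- For a closed set the limit has at least the limsup of the masses, so lower bounds for the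
  -- approximations survive.
  have hport := ProbabilityMeasure.limsup_measure_closed_le_of_tendsto hpi
    (isClosed_stayWithin ρ K (0 : Space m))
  change limsup (fun n => Measure.pi (fun _ : Fin K => θ n) (stayWithin ρ K 0)) atTop ≤
    Measure.pi (fun _ : Fin K => μ) (stayWithin ρ K 0) at hport
  refine le_trans ?_ hport
  set c : ℕ → ℝ≥0∞ := fun n => ENNReal.ofReal (1 - h / (n + N : ℕ) * ν.real univ) ^ (n + N) with hc
  -- Keep only the event that all `n + N` steps carrying large jumps vanish; its probability is at
  -- least `c n`.
  have hdom : ∀ n, c n • convPow (κ n) (n + N) ≤ θ n := fun n => by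
    have h1 : c n • Measure.dirac 0 ≤ convPow (χ n) (n + N) :=
      smul_dirac_le_convPow smul_dirac_le_bernoulliStep (n + N)
    have h2 : c n • convPow (κ n) (n + N) = convPow (κ n) (n + N) ∗ (c n • Measure.dirac 0) := by
      rw [Measure.conv_comm, Measure.conv_smul_left, Measure.dirac_zero_conv]
    rw [h2]
    exact conv_mono le_rfl h1
  have hcent : ∀ n, IsCentered (convPow (κ n) (n + N)) (h * S) := fun n => by
    have h1 := (isCentered_compensatedStep (hPi.integrable_sq_annulus hη1 (slowLevel η (n + N)))
      (q := h / (n + N : ℕ)) (by positivity) (hN (n + N) (by omega)).1).convPow (n + N)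
    refine ⟨h1.integrable_sq, h1.mean, h1.moment.trans ?_⟩
    have h2 := hPi.integral_sq_annulus_le hη1 (slowLevel η (n + N))
    have h3 : 0 ≤ ∫ u, ‖u‖ ^ 2 ∂(annulusMeasure Pi (slowLevel η (n + N)) η) :=
      integral_nonneg fun u => by positivity
    rw [← mul_assoc]
    refine mul_le_mul ?_ h2 h3 hh
    -- At `n + N = 0` the division by zero returns `0`, and the bound is just `0 ≤ h`.
    rcases Nat.eq_zero_or_pos (n + N) with h0 | h0
    · rw [h0]; simpa using hh
    · have : ((n + N : ℕ) : ℝ) ≠ 0 := by positivity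
      exact (mul_div_cancel₀ h this).le
  have hbound : ∀ n, c n ^ K * ENNReal.ofReal (1 - K * (h * S) / ρ ^ 2) ≤
      Measure.pi (fun _ : Fin K => θ n) (stayWithin ρ K 0) := fun n => by
    have := LevySDE.le_pi_stayWithin (hdom n) (hcent n) hρ K 0
    simpa using this
  have hclim : Tendsto (fun n => c n ^ K * ENNReal.ofReal (1 - K * (h * S) / ρ ^ 2)) atTop
      (𝓝 (ENNReal.ofReal (Real.exp (-(h * Pi.real {u | η < ‖u‖}))) ^ K *
        ENNReal.ofReal (1 - K * (h * S) / ρ ^ 2))) := by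
    refine ENNReal.Tendsto.mul_const (ENNReal.Tendsto.pow ?_) (Or.inr (by simp))
    have h1 := (Real.tendsto_one_add_div_pow_exp (-(h * Pi.real {u | η < ‖u‖}))).comp
      (tendsto_add_atTop_nat N)
    refine (ENNReal.tendsto_ofReal h1).congr fun n => ?_
    have h2 := (hN (n + N) (by omega)).2
    change ENNReal.ofReal ((1 + -(h * Pi.real {u | η < ‖u‖}) / ((n + N : ℕ) : ℝ)) ^ (n + N)) =
      ENNReal.ofReal (1 - h / ((n + N : ℕ) : ℝ) * ν.real univ) ^ (n + N)
    rw [← ENNReal.ofReal_pow (by linarith), hνu]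
    congr 2
    ring
  rw [← hclim.limsup_eq]
  exact limsup_le_limsup (Eventually.of_forall hbound)

end LimitBound

/-! ### Small ball estimate for the centered Lévy process. -/

section Increments

variable {m : ℕ} {Pi : Measure (Space m)}

/-- The drift that appears when only the jumps of size at most `η` are compensated. -/
def truncDrift (Pi : Measure (Space m)) (η : ℝ) : Space m :=
  -∫ u, u ∂(annulusMeasure Pi η 1)

lemma IsLevyMeasure.integral_jumpIntegrand_eq (hPi : IsLevyMeasure Pi) {η : ℝ} (hη : 0 < η)
    (hη1 : η ≤ 1) (ξ : Space m) :
    ∫ u, jumpIntegrand η ξ u ∂Pi = levyExponent Pi ξ - (⟪truncDrift Pi η, ξ⟫ : ℝ) * Complex.I := by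
  have hfin := hPi.isFiniteMeasure_annulus hη 1
  have hi := integrable_id_of_sq (hPi.integrable_sq_annulus le_rfl η)
  have h1 := hPi.integrable_jumpIntegrand one_pos le_rfl ξ
  have h2 : Integrable ((Metric.closedBall 0 1 ∩ {u | η < ‖u‖}).indicator
      (fun u : Space m => ((⟪u, ξ⟫ : ℝ) : ℂ) * Complex.I)) Pi := by
    rw [integrable_indicator_iff measurableSet_annulus]
    have := ((hi.const_inner ξ).ofReal (𝕜 := ℂ)).mul_const Complex.I
    simp_rw [real_inner_comm] at this ⊢
    exact this
  have heq : ∀ u, jumpIntegrand η ξ u = jumpIntegrand 1 ξ u +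
      (Metric.closedBall 0 1 ∩ {u | η < ‖u‖}).indicator
      (fun u : Space m => ((⟪u, ξ⟫ : ℝ) : ℂ) * Complex.I) u := fun u => by
    rcases le_or_gt ‖u‖ η with h | h
    · rw [jumpIntegrand_of_le h, jumpIntegrand_of_le (h.trans hη1), indicator_of_notMem, add_zero]
      simp [h]
    · rcases le_or_gt ‖u‖ 1 with h' | h'
      · rw [jumpIntegrand_of_lt h, jumpIntegrand_of_le h', indicator_of_mem]
        · ring
        · simp [h, h']
      · rw [jumpIntegrand_of_lt h, jumpIntegrand_of_lt h', indicator_of_notMem, add_zero]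
        simp [h']
  simp_rw [heq]
  rw [integral_add h1 h2, integral_indicator measurableSet_annulus, integral_mul_const,
    integral_complex_ofReal]
  have h3 : ∫ u in Metric.closedBall 0 1 ∩ {u | η < ‖u‖}, ⟪u, ξ⟫ ∂Pi = -⟪truncDrift Pi η, ξ⟫ := by
    rw [truncDrift, inner_neg_left, neg_neg, real_inner_comm, ← integral_inner hi]
    simp_rw [real_inner_comm]
    rfl
  rw [h3]
  push_cast
  change levyExponent Pi ξ + _ = _
  ring

variable {Ω : Type*} [MeasurableSpace Ω] {P : Measure Ω} [IsProbabilityMeasure P]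
  {U : ℝ≥0 → Ω → Space m}

lemma IsLevyProcess.charFun_centered_increment (hU : IsLevyProcess Pi U P) (hPi : IsLevyMeasure Pi)
    {η : ℝ} (hη : 0 < η) (hη1 : η ≤ 1) {s t : ℝ≥0} (hst : s ≤ t) (ξ : Space m) :
    charFun (P.map (fun ω => U t ω - U s ω + -(((t : ℝ) - s) • truncDrift Pi η))) ξ =
      Complex.exp (((t : ℝ) - s : ℝ) * ∫ u, jumpIntegrand η ξ u ∂Pi) := by
  have hmeas : Measurable (U t - U s) := (hU.measurable t).sub (hU.measurable s)
  have : P.map (fun ω => U t ω - U s ω + -(((t : ℝ) - s) • truncDrift Pi η)) =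
      (P.map (U t - U s)).map (fun x => x + -(((t : ℝ) - s) • truncDrift Pi η)) := by
    rw [Measure.map_map (by fun_prop) hmeas]; rfl
  rw [this, charFun_map_add_const, hU.charFun_increment s t hst, ← Complex.exp_add,
    hPi.integral_jumpIntegrand_eq hη hη1]
  congr 1
  rw [inner_neg_left, real_inner_smul_left]
  push_cast
  ring

/-- The process with compensated small jumps. -/
def centered (Pi : Measure (Space m)) (U : ℝ≥0 → Ω → Space m) (η : ℝ) (s : ℝ≥0) (ω : Ω) : Space m :=
  U s ω - U 0 ω - (s : ℝ) • truncDrift Pi η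

/-- The `k`-th point of the partition of `[0, t]` into `K` intervals. -/
def gridPoint (t : ℝ≥0) (K k : ℕ) : ℝ≥0 := (k : ℝ≥0) / K * t

lemma monotone_gridPoint (t : ℝ≥0) (K : ℕ) : Monotone (gridPoint t K) := fun i j hij => by
  unfold gridPoint; gcongr

lemma IsLevyProcess.measurable_centered (hU : IsLevyProcess Pi U P) (η : ℝ) (s : ℝ≥0) :
    Measurable (centered Pi U η s) :=
  ((hU.measurable s).sub (hU.measurable 0)).sub_const _

/-- The `K` increments have time length `t / K` each, so `K` cancels in both factors; this
uniformity permits refining the grid. -/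
lemma IsLevyProcess.le_measure_grid (hU : IsLevyProcess Pi U P) (hPi : IsLevyMeasure Pi)
    {η : ℝ} (hη : 0 < η) (hη1 : η ≤ 1) (t : ℝ≥0) {ρ : ℝ} (hρ : 0 < ρ) {K : ℕ} (hK : 0 < K) :
    ENNReal.ofReal (Real.exp (-(t * Pi.real {u | η < ‖u‖}))) *
      ENNReal.ofReal (1 - t * (∫ u in Metric.closedBall 0 η, ‖u‖ ^ 2 ∂Pi) / ρ ^ 2) ≤
    P {ω | ∀ k ≤ K, ‖centered Pi U η (gridPoint t K k) ω‖ ≤ ρ} := by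
  have hK' : (K : ℝ) ≠ 0 := by positivity
  set h : ℝ := t / K with hh
  have hstep : ∀ i : ℕ, ((gridPoint t K (i + 1) : ℝ≥0) : ℝ) - gridPoint t K i = h := fun i => by
    simp only [gridPoint, hh]; push_cast; field_simp; ring
  set Y : Fin K → Ω → Space m := fun i ω =>
    U (gridPoint t K (i + 1)) ω - U (gridPoint t K i) ω + -(h • truncDrift Pi η) with hY
  have hYm : ∀ i, Measurable (Y i) := fun i =>
    ((hU.measurable _).sub (hU.measurable _)).add_const _
  have hind : iIndepFun Y P := by
    have h1 := (hU.indep.nat (monotone_gridPoint t K)).precomp (Fin.val_injective (n := K))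
    exact h1.comp (fun _ x => x + -(h • truncDrift Pi η)) (fun _ => by fun_prop)
  have hprob : ∀ i, IsProbabilityMeasure (P.map (Y i)) := fun i =>
    Measure.isProbabilityMeasure_map (hYm i).aemeasurable
  have hchar : ∀ i ξ, charFun (P.map (Y i)) ξ =
      Complex.exp (h * ∫ u, jumpIntegrand η ξ u ∂Pi) := fun i ξ => by
    have := hU.charFun_centered_increment hPi hη hη1 (monotone_gridPoint t K (Nat.le_succ i)) ξ
    rw [Nat.succ_eq_add_one, hstep i] at this
    exact this
  set μ := P.map (Y ⟨0, hK⟩) with hμ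
  have hlaw : ∀ i, P.map (Y i) = μ := fun i =>
    Measure.ext_of_charFun (by ext ξ; rw [hchar, hμ, hchar])
  have hmap : P.map (fun ω i => Y i ω) = Measure.pi (fun _ : Fin K => μ) := by
    rw [hind.map_fun_eq_pi_map fun i => (hYm i).aemeasurable]
    simp_rw [hlaw]
  have key := hPi.le_pi_stayWithin hη hη1 (h := h) (by positivity) (μ := μ) (hchar ⟨0, hK⟩) hρ K
  rw [← hmap, Measure.map_apply (by fun_prop) (isClosed_stayWithin _ _ _).measurableSet,
    ← ENNReal.ofReal_pow (by positivity), ← Real.exp_nat_mul] at key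
  have e1 : (K : ℝ) * -(h * Pi.real {u | η < ‖u‖}) = -(t * Pi.real {u | η < ‖u‖}) := by
    rw [hh]; field_simp
  have e2 : (K : ℝ) * (h * ∫ u in Metric.closedBall 0 η, ‖u‖ ^ 2 ∂Pi) =
      t * ∫ u in Metric.closedBall 0 η, ‖u‖ ^ 2 ∂Pi := by
    rw [hh]; field_simp
  rw [e1, e2] at key
  refine key.trans (measure_mono fun ω hω k hk => ?_)
  refine norm_le_of_increments_mem_stayWithin (K := K)
    (z := fun k => centered Pi U η (gridPoint t K k) ω) ?_ hk
  have hz : centered Pi U η (gridPoint t K 0) ω = 0 := by simp [centered, gridPoint]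
  rw [hz]
  have hYω : (fun i : Fin K => centered Pi U η (gridPoint t K (i + 1)) ω -
      centered Pi U η (gridPoint t K i) ω) = fun i => Y i ω := by
    funext i
    simp only [hY, centered, ← hstep i, sub_smul]
    abel
  rw [hYω]
  exact hω

lemma norm_le_of_dyadic {f : ℝ≥0 → Space m} (hf : ∀ s, ContinuousWithinAt f (Ici s) s) {t : ℝ≥0}
    (ht : 0 < t) {ρ : ℝ} (h : ∀ j k, k ≤ 2 ^ j → ‖f (gridPoint t (2 ^ j) k)‖ ≤ ρ) {s : ℝ≥0}
    (hs : s ≤ t) : ‖f s‖ ≤ ρ := by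
  rcases hs.eq_or_lt with rfl | hlt
  · simpa [gridPoint] using h 0 1 (by simp)
  -- The next grid point to the right of `s`, as only right continuity is available; since `s < t`
  -- it does not pass `t`.
  set k : ℕ → ℕ := fun j => ⌊s * 2 ^ j / t⌋₊ + 1 with hk
  have hk_le : ∀ j, k j ≤ 2 ^ j := fun j => by
    have : ⌊s * 2 ^ j / t⌋₊ < 2 ^ j := by
      rw [Nat.floor_lt (by positivity), div_lt_iff₀ ht]
      push_cast
      rw [mul_comm]
      gcongr
    exact this
  have hlow : ∀ j, s ≤ gridPoint t (2 ^ j) (k j) := fun j => by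
    have := (Nat.lt_floor_add_one (s * 2 ^ j / t)).le
    rw [div_le_iff₀ ht] at this
    rw [gridPoint, div_mul_eq_mul_div, le_div_iff₀ (by positivity)]
    simpa [hk] using this
  have hup : ∀ j, gridPoint t (2 ^ j) (k j) ≤ s + t / 2 ^ j := fun j => by
    have h1 : (⌊s * 2 ^ j / t⌋₊ : ℝ≥0) ≤ s * 2 ^ j / t := Nat.floor_le (by positivity)
    rw [le_div_iff₀ ht] at h1
    rw [gridPoint, div_mul_eq_mul_div, div_le_iff₀ (by positivity)]
    simp only [hk]
    push_cast
    rw [add_mul, add_mul, one_mul, div_mul_cancel₀ _ (by positivity)]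
    gcongr
  have hlim : Tendsto (fun j => gridPoint t (2 ^ j) (k j)) atTop (𝓝 s) := by
    refine tendsto_of_tendsto_of_tendsto_of_le_of_le tendsto_const_nhds ?_ hlow hup
    have h1 : Tendsto (fun j : ℕ => t * ((1 / 2 : ℝ≥0) ^ j)) atTop (𝓝 (t * 0)) :=
      (tendsto_pow_atTop_nhds_zero_of_lt_one (by positivity)
        (by rw [div_lt_one (by norm_num)]; norm_num)).const_mul t
    have h2 := h1.const_add s
    rw [mul_zero, add_zero] at h2
    refine h2.congr fun j => ?_
    rw [one_div, inv_pow, div_eq_mul_inv]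
  have hlim' : Tendsto (fun j => f (gridPoint t (2 ^ j) (k j))) atTop (𝓝 (f s)) :=
    (hf s).tendsto.comp (tendsto_nhdsWithin_iff.2 ⟨hlim, Eventually.of_forall hlow⟩)
  exact le_of_tendsto hlim'.norm (Eventually.of_forall fun j => h j (k j) (hk_le j))

/-- A small ball estimate for the centered process. -/
theorem IsLevyProcess.exists_smallBall (hU : IsLevyProcess Pi U P) (hPi : IsLevyMeasure Pi)
    {η : ℝ} (hη : 0 < η) (hη1 : η ≤ 1) {t : ℝ≥0} (ht : 0 < t) {ρ : ℝ} (hρ : 0 < ρ) :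
    ∃ G : Set Ω, MeasurableSet G ∧
      ENNReal.ofReal (Real.exp (-(t * Pi.real {u | η < ‖u‖}))) *
        ENNReal.ofReal (1 - t * (∫ u in Metric.closedBall 0 η, ‖u‖ ^ 2 ∂Pi) / ρ ^ 2) ≤ P G ∧
      ∀ᵐ ω ∂P, ω ∈ G → ∀ s ≤ t, ‖centered Pi U η s ω‖ ≤ ρ := by
  set A : ℕ → Set Ω := fun j =>
    {ω | ∀ k ≤ 2 ^ j, ‖centered Pi U η (gridPoint t (2 ^ j) k) ω‖ ≤ ρ} with hA
  have hAm : ∀ j, MeasurableSet (A j) := fun j => by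
    have : A j = ⋂ k, ⋂ (_ : k ≤ 2 ^ j),
        {ω | ‖centered Pi U η (gridPoint t (2 ^ j) k) ω‖ ≤ ρ} := by ext; simp [hA]
    rw [this]
    exact MeasurableSet.iInter fun k => MeasurableSet.iInter fun _ =>
      measurableSet_le (hU.measurable_centered η _).norm measurable_const
  have hanti : Antitone A := antitone_nat_of_succ_le fun j ω hω k hk => by
    have h1 := hω (2 * k) (by rw [pow_succ]; omega)
    have h2 : gridPoint t (2 ^ (j + 1)) (2 * k) = gridPoint t (2 ^ j) k := by
      simp only [gridPoint]
      push_cast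
      rw [pow_succ', mul_div_mul_left _ _ (by norm_num)]
    rwa [h2] at h1
  refine ⟨⋂ j, A j, MeasurableSet.iInter hAm, ?_, ?_⟩
  · rw [hanti.measure_iInter (fun j => (hAm j).nullMeasurableSet) ⟨0, measure_ne_top _ _⟩]
    exact le_iInf fun j => hU.le_measure_grid hPi hη hη1 t hρ (by positivity)
  · filter_upwards [hU.cadlag] with ω hω hG s hs
    refine norm_le_of_dyadic (f := fun s => centered Pi U η s ω) (fun s => ?_) ht ?_ hs
    · refine ((hω s).1.sub continuousWithinAt_const).sub ?_
      exact Continuous.continuousWithinAt (by fun_prop)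
    · intro j k hk
      exact mem_iInter.1 hG j k hk

end Increments

/-! ### Càdlàg paths and Gronwall's inequality. -/

section Paths

variable {m : ℕ}

lemma IsCadlag.exists_norm_le {f : ℝ≥0 → Space m} (hf : IsCadlag f) (t : ℝ≥0) :
    ∃ M, ∀ s ≤ t, ‖f s‖ ≤ M := by
  have key : ∃ M, ∀ s ∈ Icc 0 t, ‖f s‖ ≤ M := by
    refine isCompact_Icc.induction_on (p := fun S => ∃ M, ∀ s ∈ S, ‖f s‖ ≤ M)
      ⟨0, by simp⟩ ?_ ?_ ?_
    · rintro S T hST ⟨M, hM⟩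
      exact ⟨M, fun s hs => hM s (hST hs)⟩
    · rintro S T ⟨M, hM⟩ ⟨N, hN⟩
      refine ⟨max M N, fun s hs => ?_⟩
      rcases hs with hs | hs
      · exact (hM s hs).trans (le_max_left _ _)
      · exact (hN s hs).trans (le_max_right _ _)
    · intro s _
      obtain ⟨hr, l, hl⟩ := hf s
      have h1 : ∀ᶠ r in 𝓝[≥] s, ‖f r‖ ≤ max (‖f s‖ + 1) (‖l‖ + 1) :=
        (hr.norm.eventually_lt_const (lt_add_one _)).mono fun r h => h.le.trans (le_max_left _ _)
      have h2 : ∀ᶠ r in 𝓝[<] s, ‖f r‖ ≤ max (‖f s‖ + 1) (‖l‖ + 1) :=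
        (hl.norm.eventually_lt_const (lt_add_one _)).mono fun r h => h.le.trans (le_max_right _ _)
      have h3 : ∀ᶠ r in 𝓝 s, ‖f r‖ ≤ max (‖f s‖ + 1) (‖l‖ + 1) := by
        rw [← nhdsLT_sup_nhdsGE]
        exact eventually_sup.2 ⟨h2, h1⟩
      exact ⟨_, mem_nhdsWithin_of_mem_nhds h3, _, fun r hr => hr⟩
  obtain ⟨M, hM⟩ := key
  exact ⟨M, fun s hs => hM s ⟨zero_le, hs⟩⟩

lemma measurable_of_rightContinuous {E : Type*} [TopologicalSpace E]
    [TopologicalSpace.PseudoMetrizableSpace E] [MeasurableSpace E] [BorelSpace E] {g : ℝ → E}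
    (hg : ∀ r, ContinuousWithinAt g (Ici r) r) : Measurable g := by
  refine measurable_of_tendsto_metrizable
    (f := fun (n : ℕ) r => g ((⌊((n : ℝ) + 1) * r⌋ + 1) / ((n : ℝ) + 1))) (fun n => ?_) ?_
  · exact (measurable_from_top (f := fun k : ℤ => g (((k : ℝ) + 1) / ((n : ℝ) + 1)))).comp
      (Int.measurable_floor.comp (measurable_const_mul _))
  · rw [tendsto_pi_nhds]
    intro r
    have hlow : ∀ n : ℕ, r ≤ (⌊((n : ℝ) + 1) * r⌋ + 1) / ((n : ℝ) + 1) := fun n => by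
      rw [le_div_iff₀ (by positivity), mul_comm]
      exact (Int.lt_floor_add_one _).le
    have hup : ∀ n : ℕ, (⌊((n : ℝ) + 1) * r⌋ + 1) / ((n : ℝ) + 1) ≤ r + 1 / ((n : ℝ) + 1) :=
      fun n => by
        have hn : (0 : ℝ) < n + 1 := by positivity
        rw [add_div]
        gcongr
        rw [div_le_iff₀ hn, mul_comm]
        exact Int.floor_le _
    have hlim : Tendsto (fun n : ℕ => ((⌊((n : ℝ) + 1) * r⌋ : ℝ) + 1) / ((n : ℝ) + 1)) atTop (𝓝 r) := by
      refine tendsto_of_tendsto_of_tendsto_of_le_of_le tendsto_const_nhds ?_ hlow hup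
      simpa using (tendsto_one_div_add_atTop_nhds_zero_nat (𝕜 := ℝ)).const_add r
    exact (hg r).tendsto.comp (tendsto_nhdsWithin_iff.2 ⟨hlim, Eventually.of_forall hlow⟩)

lemma IsCadlag.continuousWithinAt_toNNReal {f : ℝ≥0 → Space m} (hf : IsCadlag f) (r : ℝ) :
    ContinuousWithinAt (fun r : ℝ => f r.toNNReal) (Ici r) r :=
  (hf r.toNNReal).1.comp continuous_real_toNNReal.continuousWithinAt
    fun _ hs => Real.toNNReal_le_toNNReal hs

lemma intervalIntegrable_of_rightContinuous {E : Type*} [NormedAddCommGroup E] [MeasurableSpace E]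
    [BorelSpace E] [SecondCountableTopology E] {g : ℝ → E}
    (hg : ∀ r, ContinuousWithinAt g (Ici r) r) {t M : ℝ} (hM : ∀ r ∈ Icc 0 t, ‖g r‖ ≤ M) {s : ℝ}
    (hs : s ∈ Icc 0 t) : IntervalIntegrable g volume 0 s := by
  rw [intervalIntegrable_iff_integrableOn_Ioc_of_le hs.1]
  refine IntegrableOn.of_bound (by simp) (measurable_of_rightContinuous hg).aestronglyMeasurable M ?_
  refine (ae_restrict_mem measurableSet_Ioc).mono fun r hr => ?_
  exact hM r ⟨hr.1.le, hr.2.trans hs.2⟩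

/-- Gronwall's inequality in integral form for right continuous functions. -/
lemma gronwall_of_rightContinuous {w : ℝ → ℝ} (hw : ∀ r, ContinuousWithinAt w (Ici r) r)
    {t M L c : ℝ} (ht : 0 ≤ t) (hM : ∀ r ∈ Icc 0 t, ‖w r‖ ≤ M) (hw0 : ∀ r, 0 ≤ w r) (hL : 0 < L)
    (h : ∀ s ∈ Icc 0 t, w s ≤ c + L * ∫ r in (0 : ℝ)..s, w r) : w t ≤ c * Real.exp (L * t) := by
  set F : ℝ → ℝ := fun s => ∫ r in (0 : ℝ)..s, w r with hF
  have hint : ∀ s ∈ Icc 0 t, IntervalIntegrable w volume 0 s := fun s hs =>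
    intervalIntegrable_of_rightContinuous hw hM hs
  have hF0 : ∀ s ∈ Icc 0 t, 0 ≤ F s := fun s hs =>
    intervalIntegral.integral_nonneg hs.1 fun r _ => hw0 r
  have hcont : ContinuousOn F (Icc 0 t) := by
    have := intervalIntegral.continuousOn_primitive_interval (a := 0) (b := t) (f := w)
      (μ := volume) ?_
    · rwa [uIcc_of_le ht] at this
    · rw [uIcc_of_le ht, integrableOn_Icc_iff_integrableOn_Ioc]
      exact (intervalIntegrable_iff_integrableOn_Ioc_of_le ht).1 (hint t ⟨ht, le_rfl⟩)
  have hder : ∀ s ∈ Ico 0 t, HasDerivWithinAt F (w s) (Ici s) s := fun s hs =>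
    intervalIntegral.integral_hasDerivWithinAt_right (t := Ioi s) (hint s ⟨hs.1, hs.2.le⟩)
      (measurable_of_rightContinuous hw).stronglyMeasurable.stronglyMeasurableAtFilter
      ((hw s).mono Ioi_subset_Ici_self)
  -- The primitive `F` is continuous with right derivative `w ≤ L F + c`, so the differential form
  -- of Gronwall applies to it.
  have hgr := norm_le_gronwallBound_of_norm_deriv_right_le hcont hder (δ := 0) (K := L) (ε := c)
    (by simp [hF]) (fun s hs => by
      have hs' : s ∈ Icc 0 t := ⟨hs.1, hs.2.le⟩
      rw [Real.norm_of_nonneg (hw0 s), Real.norm_of_nonneg (hF0 s hs')]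
      linarith [h s hs']) t ⟨ht, le_rfl⟩
  rw [Real.norm_of_nonneg (hF0 t ⟨ht, le_rfl⟩), gronwallBound_of_K_ne_0 hL.ne', sub_zero] at hgr
  calc w t ≤ c + L * F t := h t ⟨ht, le_rfl⟩
    _ ≤ c + L * (0 * Real.exp (L * t) + c / L * (Real.exp (L * t) - 1)) := by gcongr
    _ = c * Real.exp (L * t) := by field_simp; ring

end Paths

/-! ### Dependence of the solution on the driving path. -/

section Solutions

variable {m : ℕ}

lemma SmoothBoundedDerivatives.exists_lipschitz {a : Space m → Space m}
    (ha : SmoothBoundedDerivatives a) : ∃ L : ℝ, 0 < L ∧ ∀ y z, ‖a y - a z‖ ≤ L * ‖y - z‖ := by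
  obtain ⟨C, hC⟩ := ha.2 1 le_rfl
  have hd : Differentiable ℝ a := ha.1.differentiable (by simp)
  refine ⟨max C 1, by positivity, fun y z => ?_⟩
  refine Convex.norm_image_sub_le_of_norm_fderiv_le (s := univ) (fun x _ => hd x) (fun x _ => ?_)
    convex_univ (mem_univ z) (mem_univ y)
  rw [← norm_iteratedFDeriv_one]
  exact (hC x).trans (le_max_left _ _)

variable {a : Space m → Space m} {L : ℝ}

lemma dist_paths_le (hL : 0 < L) (ha : ∀ y z, ‖a y - a z‖ ≤ L * ‖y - z‖) {f g z z' : ℝ≥0 → Space m}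
    (hf : IsCadlag f) (hg : IsCadlag g) {t : ℝ≥0} {x : Space m}
    (hfe : ∀ s ≤ t, f s = x + (∫ r in (0 : ℝ)..s, a (f r.toNNReal)) + z s)
    (hge : ∀ s ≤ t, g s = x + (∫ r in (0 : ℝ)..s, a (g r.toNNReal)) + z' s) {c : ℝ}
    (hz : ∀ s ≤ t, ‖z s - z' s‖ ≤ c) : ‖f t - g t‖ ≤ c * Real.exp (L * t) := by
  have hac : Continuous a := by
    refine LipschitzWith.continuous (K := L.toNNReal) (LipschitzWith.of_dist_le_mul fun y z => ?_)
    rw [dist_eq_norm, dist_eq_norm, Real.coe_toNNReal _ hL.le]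
    exact ha y z
  have hfr := hf.continuousWithinAt_toNNReal
  have hgr := hg.continuousWithinAt_toNNReal
  obtain ⟨M, hM⟩ := hf.exists_norm_le t
  obtain ⟨N, hN⟩ := hg.exists_norm_le t
  have hle : ∀ r ∈ Icc (0 : ℝ) t, r.toNNReal ≤ t := fun r hr => Real.toNNReal_le_iff_le_coe.2 hr.2
  have hbound : ∀ {k : ℝ≥0 → Space m} {M : ℝ}, (∀ s ≤ t, ‖k s‖ ≤ M) → ∀ r ∈ Icc (0 : ℝ) t,
      ‖a (k r.toNNReal)‖ ≤ ‖a 0‖ + L * M := fun {k M} hk r hr => by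
    have h1 := ha (k r.toNNReal) 0
    rw [sub_zero] at h1
    have h2 := norm_le_norm_add_norm_sub' (a (k r.toNNReal)) (a 0)
    have h3 := mul_le_mul_of_nonneg_left (hk _ (hle r hr)) hL.le
    linarith
  have hw : ∀ r, ContinuousWithinAt (fun r : ℝ => ‖f r.toNNReal - g r.toNNReal‖) (Ici r) r :=
    fun r => ((hfr r).sub (hgr r)).norm
  have hwM : ∀ r ∈ Icc (0 : ℝ) t, ‖‖f r.toNNReal - g r.toNNReal‖‖ ≤ M + N := fun r hr => by
    rw [norm_norm]
    exact (norm_sub_le _ _).trans (add_le_add (hM _ (hle r hr)) (hN _ (hle r hr)))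
  have key := gronwall_of_rightContinuous hw t.2 hwM (fun r => norm_nonneg _) hL (c := c)
    (fun s hs => ?_)
  · simpa using key
  · have hs1 : s.toNNReal ≤ t := hle s hs
    have hs2 : ((s.toNNReal : ℝ≥0) : ℝ) = s := Real.coe_toNNReal s hs.1
    have i1 : IntervalIntegrable (fun r : ℝ => a (f r.toNNReal)) volume 0 s :=
      intervalIntegrable_of_rightContinuous
      (fun r => hac.continuousAt.comp_continuousWithinAt (hfr r)) (hbound hM) hs
    have i2 : IntervalIntegrable (fun r : ℝ => a (g r.toNNReal)) volume 0 s :=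
      intervalIntegrable_of_rightContinuous
      (fun r => hac.continuousAt.comp_continuousWithinAt (hgr r)) (hbound hN) hs
    have i3 := intervalIntegrable_of_rightContinuous hw hwM hs
    have heq : f s.toNNReal - g s.toNNReal =
        (∫ r in (0 : ℝ)..s, (a (f r.toNNReal) - a (g r.toNNReal))) +
          (z s.toNNReal - z' s.toNNReal) := by
      rw [intervalIntegral.integral_sub i1 i2, hfe _ hs1, hge _ hs1, hs2]
      abel
    rw [heq, add_comm c, ← intervalIntegral.integral_const_mul]
    refine (norm_add_le _ _).trans (add_le_add ?_ (hz _ hs1))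
    exact intervalIntegral.norm_integral_le_of_norm_le hs.1
      (ae_of_all _ fun r _ => ha _ _) (i3.const_mul L)

lemma norm_path_le (hL : 0 < L) (ha : ∀ y z, ‖a y - a z‖ ≤ L * ‖y - z‖) {f z : ℝ≥0 → Space m}
    (hf : IsCadlag f) {t : ℝ≥0} {x : Space m}
    (hfe : ∀ s ≤ t, f s = x + (∫ r in (0 : ℝ)..s, a (f r.toNNReal)) + z s) {c : ℝ}
    (hz : ∀ s ≤ t, ‖z s‖ ≤ c) : ‖f t‖ ≤ (‖x‖ + t * ‖a 0‖ + c) * Real.exp (L * t) := by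
  have hg : IsCadlag (fun _ : ℝ≥0 => (0 : Space m)) := fun s =>
    ⟨continuousWithinAt_const, 0, tendsto_const_nhds⟩
  -- The zero path solves the equation driven by `-x - s • a 0`, so the stability estimate also
  -- bounds a single path.
  have := dist_paths_le hL ha (x := x) hf hg (z' := fun s => -x - (s : ℝ) • a 0) hfe
    (c := ‖x‖ + t * ‖a 0‖ + c) (fun s _ => by simp) (fun s hs => ?_)
  · simpa using this
  · have h1 : z s - (-x - (s : ℝ) • a 0) = x + (s : ℝ) • a 0 + z s := by abel
    rw [h1]
    refine (norm_add_le _ _).trans (add_le_add ((norm_add_le _ _).trans ?_) (hz s hs))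
    rw [norm_smul, Real.norm_of_nonneg s.coe_nonneg]
    gcongr

end Solutions

/-! ### Small balls charged by the solution. -/

section SmallBall

variable {m : ℕ} {Pi : Measure (Space m)} {Ω : Type*} [MeasurableSpace Ω] {P : Measure Ω}
  [IsProbabilityMeasure P] {U X : ℝ≥0 → Ω → Space m} {a : Space m → Space m} {x : Space m} {L : ℝ}

/-- The solution stays with a quantified probability in a small ball whose centre is controlled. -/
theorem IsSolution.exists_smallBall (hX : IsSolution a x U X P) (hU : IsLevyProcess Pi U P)
    (hPi : IsLevyMeasure Pi) (hL : 0 < L) (ha : ∀ y z, ‖a y - a z‖ ≤ L * ‖y - z‖) {t : ℝ≥0}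
    (ht : 0 < t) {η : ℝ} (hη : 0 < η) (hη1 : η ≤ 1) {ρ : ℝ} (hρ : 0 < ρ) :
    ∃ y : Space m, ‖y‖ ≤ (‖x‖ + t * ‖a 0‖ + (ρ + t * ‖truncDrift Pi η‖)) * Real.exp (L * t) ∧
      ENNReal.ofReal (Real.exp (-(t * Pi.real {u | η < ‖u‖}))) *
        ENNReal.ofReal (1 - t * (∫ u in Metric.closedBall 0 η, ‖u‖ ^ 2 ∂Pi) / ρ ^ 2) ≤
      P.map (X t) (Metric.closedBall y (2 * ρ * Real.exp (L * t))) := by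
  obtain ⟨G, hG, hPG, hGae⟩ := hU.exists_smallBall hPi hη hη1 ht hρ
  set good : Ω → Prop := fun ω => IsCadlag (fun s => X s ω) ∧
    (∀ s ≤ t, X s ω = x + (∫ r in (0 : ℝ)..s, a (X r.toNNReal ω)) + (U s ω - U 0 ω)) ∧
    (ω ∈ G → ∀ s ≤ t, ‖centered Pi U η s ω‖ ≤ ρ) with hgood
  have hgood_ae : ∀ᵐ ω ∂P, good ω := by
    filter_upwards [hX.cadlag, hX.eqn, hGae] with ω h1 h2 h3
    exact ⟨h1, fun s _ => by rw [h2 s]; abel, h3⟩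
  -- Any good sample in `G` supplies the centre. Without one, `G` is null, the lower bound is zero
  -- and every centre works.
  by_cases hex : ∃ ω₀, good ω₀ ∧ ω₀ ∈ G
  · obtain ⟨ω₀, hω₀, hω₀G⟩ := hex
    refine ⟨X t ω₀, norm_path_le hL ha hω₀.1 hω₀.2.1 fun s hs => ?_, hPG.trans ?_⟩
    · have h1 := hω₀.2.2 hω₀G s hs
      have h2 : U s ω₀ - U 0 ω₀ = centered Pi U η s ω₀ + (s : ℝ) • truncDrift Pi η := by
        rw [centered]; abel
      rw [h2]
      refine (norm_add_le _ _).trans (add_le_add h1 ?_)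
      rw [norm_smul, Real.norm_of_nonneg s.coe_nonneg]
      gcongr
    · rw [Measure.map_apply (hX.measurable t) measurableSet_closedBall]
      refine measure_mono_ae ?_
      filter_upwards [hgood_ae] with ω hω hωG
      change X t ω ∈ Metric.closedBall (X t ω₀) _
      rw [Metric.mem_closedBall, dist_eq_norm]
      refine dist_paths_le hL ha hω.1 hω₀.1 hω.2.1 hω₀.2.1 fun s hs => ?_
      have h1 := hω.2.2 hωG s hs
      have h2 := hω₀.2.2 hω₀G s hs
      have h3 : U s ω - U 0 ω - (U s ω₀ - U 0 ω₀) =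
          centered Pi U η s ω - centered Pi U η s ω₀ := by
        simp only [centered]; abel
      rw [h3]
      linarith [norm_sub_le (centered Pi U η s ω) (centered Pi U η s ω₀)]
  · refine ⟨0, by rw [norm_zero]; positivity, ?_⟩
    have : P G = 0 := by
      refine measure_mono_null (fun ω hω => ?_) (ae_iff.1 hgood_ae)
      exact fun h => hex ⟨ω, h, hω⟩
    rw [this] at hPG
    exact hPG.trans zero_le

end SmallBall

/-! ### From one-dimensional tails to the tail of the norm. -/

section Averaging

variable {m : ℕ} {Pi : Measure (Space m)}

/-- The part of the unit ball close to the hyperplane orthogonal to `w`. -/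
def slab (w : Space m) (r : ℝ) : Set (Space m) := {v | |⟪w, v⟫| ≤ r}

lemma isClosed_slab (w : Space m) (r : ℝ) : IsClosed (slab w r) :=
  isClosed_le (by fun_prop) continuous_const

/-- The reflection exchanging `w` and `w'` preserves volume and the unit ball. -/
lemma volume_slab_eq {w w' : Space m} (h : ‖w‖ = ‖w'‖) (r : ℝ) :
    volume.restrict (Metric.closedBall 0 1) (slab w r) =
      volume.restrict (Metric.closedBall 0 1) (slab w' r) := by
  set R := (ℝ ∙ (w - w'))ᗮ.reflection with hR
  have hRw : R w = w' := Submodule.reflection_sub h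
  have hm : MeasurableSet (slab w' r ∩ Metric.closedBall 0 1) :=
    (isClosed_slab w' r).measurableSet.inter measurableSet_closedBall
  rw [Measure.restrict_apply (isClosed_slab w r).measurableSet,
    Measure.restrict_apply (isClosed_slab w' r).measurableSet,
    ← R.measurePreserving.measure_preimage hm.nullMeasurableSet]
  congr 1
  ext v
  simp only [slab, mem_inter_iff, mem_ofPred_eq, Metric.mem_closedBall, dist_zero_right, mem_preimage,
    LinearIsometryEquiv.norm_map]
  rw [← hRw, R.inner_map_map]

/-- For one direction the slabs shrink to a null hyperplane; symmetry then makes `r` uniform over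
directions. -/
lemma exists_slab_small {δ : ℝ} (hδ : 0 < δ) :
    ∃ r : ℝ, 0 < r ∧ r ≤ 1 ∧ ∀ w : Space m, ‖w‖ = 1 →
      volume.restrict (Metric.closedBall 0 1) (slab w r) ≤
        ENNReal.ofReal δ * volume (Metric.closedBall (0 : Space m) 1) := by
  by_cases hex : ∃ w₀ : Space m, ‖w₀‖ = 1
  swap
  · exact ⟨1, one_pos, le_rfl, fun w hw => absurd ⟨w, hw⟩ hex⟩
  obtain ⟨w₀, hw₀⟩ := hex
  have hV : 0 < volume (Metric.closedBall (0 : Space m) 1) :=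
    Metric.measure_closedBall_pos _ _ one_pos
  have hanti : Antitone (fun n : ℕ => slab w₀ (1 / ((n : ℝ) + 1))) := fun i j hij v hv => by
    have hv' : |⟪w₀, v⟫| ≤ 1 / ((j : ℝ) + 1) := hv
    exact hv'.trans (by gcongr)
  have hfin : IsFiniteMeasure (volume.restrict (Metric.closedBall (0 : Space m) 1)) :=
    ⟨by simpa using measure_closedBall_lt_top⟩
  have hlim := tendsto_measure_iInter_atTop (μ := volume.restrict (Metric.closedBall (0 : Space m) 1))
    (fun n : ℕ => (isClosed_slab w₀ (1 / ((n : ℝ) + 1))).measurableSet.nullMeasurableSet) hanti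
    ⟨0, measure_ne_top _ _⟩
  have hzero : volume.restrict (Metric.closedBall (0 : Space m) 1)
      (⋂ n : ℕ, slab w₀ (1 / ((n : ℝ) + 1))) = 0 := by
    refine measure_mono_null (t := ((ℝ ∙ w₀)ᗮ : Submodule ℝ (Space m))) (fun v hv => ?_)
      (Measure.absolutelyContinuous_of_le Measure.restrict_le_self ?_)
    · rw [SetLike.mem_coe, Submodule.mem_orthogonal_singleton_iff_inner_right]
      have h1 : ∀ n : ℕ, |⟪w₀, v⟫| ≤ 1 / ((n : ℝ) + 1) := fun n => mem_iInter.1 hv n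
      have h2 := ge_of_tendsto' (tendsto_one_div_add_atTop_nhds_zero_nat (𝕜 := ℝ)) h1
      exact abs_nonpos_iff.1 h2
    · refine Measure.addHaar_submodule _ _ fun htop => ?_
      have h1 : w₀ ∈ (ℝ ∙ w₀)ᗮ := htop ▸ Submodule.mem_top
      rw [Submodule.mem_orthogonal_singleton_iff_inner_right, real_inner_self_eq_norm_sq, hw₀] at h1
      norm_num at h1
  rw [hzero] at hlim
  have hpos : 0 < ENNReal.ofReal δ * volume (Metric.closedBall (0 : Space m) 1) :=
    ENNReal.mul_pos (by simpa using hδ) hV.ne'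
  obtain ⟨n, hn⟩ := (hlim.eventually_lt_const hpos).exists
  refine ⟨1 / ((n : ℝ) + 1), by positivity, ?_, fun w hw => ?_⟩
  · rw [div_le_one (by positivity)]; linarith [(Nat.cast_nonneg n : (0 : ℝ) ≤ n)]
  · rw [volume_slab_eq (hw.trans hw₀.symm)]
    exact hn.le

/-- Averaging over directions: the tail of `Π` is controlled by its one-dimensional tails, with a
constant as close to one as desired. -/
lemma IsLevyMeasure.tail_le (hPi : IsLevyMeasure Pi) {δ r : ℝ} (hδ : 0 < δ)
    (hr : 0 < r)
    (hslab : ∀ w : Space m, ‖w‖ = 1 → volume.restrict (Metric.closedBall 0 1) (slab w r) ≤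
        ENNReal.ofReal δ * volume (Metric.closedBall (0 : Space m) 1))
    {ε : ℝ} (hε : 0 < ε) {S : ℝ≥0∞} (hS : ∀ v : Space m, ‖v‖ = 1 → Pi {u | ε < |⟪u, v⟫|} ≤ S) :
    ENNReal.ofReal (1 - δ) * Pi {u | ε / r < ‖u‖} ≤ S := by
  set B := Metric.closedBall (0 : Space m) 1 with hB
  have hV0 : volume B ≠ 0 := (Metric.measure_closedBall_pos _ _ one_pos).ne'
  have hVtop : volume B ≠ ∞ := measure_closedBall_lt_top.ne
  have hfin := hPi.isFiniteMeasure_gt (div_pos hε hr)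
  have hfinB : IsFiniteMeasure (volume.restrict B) := ⟨by simpa using hVtop.lt_top⟩
  set ν := Pi.restrict {u | ε / r < ‖u‖} with hν
  set T : Set (Space m × Space m) := {q | ε < |⟪q.2, q.1⟫|} with hT
  have hTm : MeasurableSet T :=
    (isOpen_lt continuous_const (by fun_prop : Continuous fun q : Space m × Space m =>
      |⟪q.2, q.1⟫|)).measurableSet
  -- Fubini on `T`, slicing first at `v`: normalizing `v` in the unit ball only enlarges `|⟪u, v⟫|`,
  -- so each slice has mass at most `S`.
  have hup : (volume.restrict B).prod ν T ≤ volume B * S := by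
    rw [Measure.prod_apply hTm]
    calc ∫⁻ v in B, ν (Prod.mk v ⁻¹' T) ≤ ∫⁻ v in B, S := by
          refine setLIntegral_mono measurable_const fun v hv => ?_
          rcases eq_or_ne v 0 with rfl | hv0
          · have : Prod.mk (0 : Space m) ⁻¹' T = ∅ := by
              ext u; simp [hT, hε.le]
            rw [this, measure_empty]
            exact zero_le
          · have hvn : 0 < ‖v‖ := norm_pos_iff.2 hv0
            have hv1 : ‖v‖ ≤ 1 := by simpa [hB] using hv
            refine (Measure.restrict_apply_le _ _).trans ((measure_mono fun u hu => ?_).trans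
              (hS (‖v‖⁻¹ • v) (by rw [norm_smul, norm_inv, norm_norm, inv_mul_cancel₀ hvn.ne'])))
            have hu' : ε < |⟪u, v⟫| := hu
            change ε < |⟪u, ‖v‖⁻¹ • v⟫|
            rw [real_inner_smul_right, abs_mul, abs_of_pos (inv_pos.2 hvn)]
            refine hu'.trans_le (le_mul_of_one_le_left (abs_nonneg _) ?_)
            exact (one_le_inv₀ hvn).2 hv1
      _ = volume B * S := by rw [setLIntegral_const, mul_comm]
  -- Slicing at `u` with `‖u‖ > ε / r`: the vectors `v` missing from the slice lie in a slab of
  -- half-width `r`, a fraction at most `δ` of the ball.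
  have hlow : ENNReal.ofReal (1 - δ) * volume B * ν univ ≤ (volume.restrict B).prod ν T := by
    rw [Measure.prod_apply_symm hTm, ← lintegral_const]
    refine lintegral_mono_ae ((ae_restrict_mem measurableSet_norm_gt).mono fun u hu => ?_)
    have hu' : ε / r < ‖u‖ := hu
    have hun : 0 < ‖u‖ := (div_pos hε hr).trans hu'
    have hw : ‖‖u‖⁻¹ • u‖ = 1 := by rw [norm_smul, norm_inv, norm_norm, inv_mul_cancel₀ hun.ne']
    have hcompl : ((fun v => (v, u)) ⁻¹' T)ᶜ ⊆ slab (‖u‖⁻¹ • u) r := fun v hv => by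
      have hv' : |⟪u, v⟫| ≤ ε := by simpa [hT] using hv
      change |⟪‖u‖⁻¹ • u, v⟫| ≤ r
      rw [real_inner_smul_left, abs_mul, abs_of_pos (inv_pos.2 hun), inv_mul_le_iff₀ hun]
      rw [div_lt_iff₀ hr] at hu'
      linarith
    have hsum : volume B ≤ volume.restrict B ((fun v => (v, u)) ⁻¹' T) +
        ENNReal.ofReal δ * volume B := by
      calc volume B = volume.restrict B univ := by simp
        _ ≤ volume.restrict B ((fun v => (v, u)) ⁻¹' T) +
            volume.restrict B ((fun v => (v, u)) ⁻¹' T)ᶜ := by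
          rw [← union_compl_self ((fun v => (v, u)) ⁻¹' T)]
          exact measure_union_le _ _
        _ ≤ _ := by
          gcongr
          exact (measure_mono hcompl).trans (hslab _ hw)
    rw [ENNReal.ofReal_sub _ hδ.le, ENNReal.ofReal_one, ENNReal.sub_mul (fun _ _ => hVtop), one_mul]
    exact tsub_le_iff_right.2 hsum
  have hfinal := hlow.trans hup
  rw [mul_comm (ENNReal.ofReal (1 - δ)), mul_assoc] at hfinal
  have h2 := (ENNReal.mul_le_mul_iff_right hV0 hVtop).1 hfinal
  simpa [hν] using h2

end Averaging

/-! ### Consequences of a bound on the lower order function. -/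

section Index

variable {m : ℕ} {Pi : Measure (Space m)}

lemma lintegral_le_of_lowerOrderFun_le {ε T : ℝ} (hε : 0 < ε) (hε1 : ε < 1) (hT : 0 ≤ T)
    (h : lowerOrderFun Pi ε ≤ ENNReal.ofReal T) {v : Space m} (hv : ‖v‖ = 1) :
    ∫⁻ u, ENNReal.ofReal ((min |⟪u, v⟫| ε) ^ 2) ∂Pi ≤
      ENNReal.ofReal (T * (ε ^ 2 * Real.log (1 / ε))) := by
  have hlog : 0 < Real.log (1 / ε) := Real.log_pos (by rw [lt_div_iff₀ hε]; linarith)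
  have hc : 0 < ε ^ 2 * Real.log (1 / ε) := by positivity
  rw [lowerOrderFun, ENNReal.inv_mul_le_iff (by simpa using hc) ENNReal.ofReal_ne_top, mul_comm,
    ← ENNReal.ofReal_mul hT] at h
  refine le_trans ?_ h
  exact le_iSup₂_of_le (f := fun (v : Space m) (_ : v ∈ Metric.sphere (0 : Space m) 1) =>
    ∫⁻ u, ENNReal.ofReal ((min |⟪u, v⟫| ε) ^ 2) ∂Pi) v (by simpa using hv) le_rfl

lemma measure_gt_le_of_lowerOrderFun_le {ε T : ℝ} (hε : 0 < ε) (hε1 : ε < 1) (hT : 0 ≤ T)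
    (h : lowerOrderFun Pi ε ≤ ENNReal.ofReal T) {v : Space m} (hv : ‖v‖ = 1) :
    Pi {u | ε < |⟪u, v⟫|} ≤ ENNReal.ofReal (T * Real.log (1 / ε)) := by
  have h1 := lintegral_le_of_lowerOrderFun_le hε hε1 hT h hv
  have h2 : ENNReal.ofReal (ε ^ 2) * Pi {u | ε < |⟪u, v⟫|} ≤
      ∫⁻ u, ENNReal.ofReal ((min |⟪u, v⟫| ε) ^ 2) ∂Pi := by
    rw [← setLIntegral_const]
    refine (setLIntegral_mono (by fun_prop) fun u hu => ?_).trans (setLIntegral_le_lintegral _ _)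
    have hu' : ε < |⟪u, v⟫| := hu
    rw [min_eq_right hu'.le]
  have h3 := h2.trans h1
  have h4 : T * (ε ^ 2 * Real.log (1 / ε)) = ε ^ 2 * (T * Real.log (1 / ε)) := by ring
  rw [h4, ENNReal.ofReal_mul (by positivity)] at h3
  exact (ENNReal.mul_le_mul_iff_right (by simpa using hε.ne') ENNReal.ofReal_ne_top).1 h3

/-- Sum over the coordinates: when `‖u‖ ≤ ε / r`, each `|u i|` is at most `r⁻¹` times its truncation
at `ε`. -/
lemma integral_sq_le_of_lowerOrderFun_le {ε T r : ℝ}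
    (hε : 0 < ε) (hε1 : ε < 1) (hT : 0 ≤ T) (h : lowerOrderFun Pi ε ≤ ENNReal.ofReal T)
    (hr : 0 < r) (hr1 : r ≤ 1) :
    ∫ u in Metric.closedBall 0 (ε / r), ‖u‖ ^ 2 ∂Pi ≤
      m * (r⁻¹ ^ 2 * (T * (ε ^ 2 * Real.log (1 / ε)))) := by
  have hlog : 0 < Real.log (1 / ε) := Real.log_pos (by rw [lt_div_iff₀ hε]; linarith)
  rw [integral_eq_lintegral_of_nonneg_ae (ae_of_all _ fun u => by positivity) (by fun_prop)]
  refine ENNReal.toReal_le_of_le_ofReal (by positivity) ?_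
  have hr2 : 1 ≤ r⁻¹ := (one_le_inv₀ hr).2 hr1
  calc ∫⁻ u in Metric.closedBall 0 (ε / r), ENNReal.ofReal (‖u‖ ^ 2) ∂Pi
      ≤ ∫⁻ u in Metric.closedBall 0 (ε / r), ∑ i : Fin m, ENNReal.ofReal (r⁻¹ ^ 2) *
          ENNReal.ofReal ((min |⟪u, EuclideanSpace.single i (1 : ℝ)⟫| ε) ^ 2) ∂Pi := by
        refine setLIntegral_mono (by fun_prop) fun u hu => ?_
        have hu' : ‖u‖ ≤ ε / r := by simpa using hu
        rw [EuclideanSpace.real_norm_sq_eq, ENNReal.ofReal_sum_of_nonneg fun i _ => by positivity]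
        refine Finset.sum_le_sum fun i _ => ?_
        rw [← ENNReal.ofReal_mul (by positivity)]
        refine ENNReal.ofReal_le_ofReal ?_
        have hi : |u i| ≤ ε / r := ((PiLp.norm_apply_le u i).trans hu')
        have hin : ⟪u, EuclideanSpace.single i (1 : ℝ)⟫ = u i := by
          simp [EuclideanSpace.inner_single_right]
        rw [hin, ← sq_abs, ← mul_pow]
        refine pow_le_pow_left₀ (abs_nonneg _) ?_ 2
        rcases le_total |u i| ε with h' | h'
        · rw [min_eq_left h']
          exact le_mul_of_one_le_left (abs_nonneg _) hr2
        · rw [min_eq_right h', mul_comm, ← div_eq_mul_inv]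
          exact hi
    _ ≤ ∫⁻ u, ∑ i : Fin m, ENNReal.ofReal (r⁻¹ ^ 2) *
          ENNReal.ofReal ((min |⟪u, EuclideanSpace.single i (1 : ℝ)⟫| ε) ^ 2) ∂Pi :=
        setLIntegral_le_lintegral _ _
    _ = ∑ i : Fin m, ENNReal.ofReal (r⁻¹ ^ 2) *
          ∫⁻ u, ENNReal.ofReal ((min |⟪u, EuclideanSpace.single i (1 : ℝ)⟫| ε) ^ 2) ∂Pi := by
        rw [lintegral_finsetSum _ fun i _ => by fun_prop]
        refine Finset.sum_congr rfl fun i _ => ?_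
        rw [lintegral_const_mul _ (by fun_prop)]
    _ ≤ ∑ _i : Fin m, ENNReal.ofReal (r⁻¹ ^ 2) *
          ENNReal.ofReal (T * (ε ^ 2 * Real.log (1 / ε))) := by
        gcongr with i
        exact lintegral_le_of_lowerOrderFun_le hε hε1 hT h (by simp)
    _ = ENNReal.ofReal (m * (r⁻¹ ^ 2 * (T * (ε ^ 2 * Real.log (1 / ε))))) := by
        rw [Finset.sum_const, Finset.card_univ, Fintype.card_fin, nsmul_eq_mul,
          ENNReal.ofReal_mul (Nat.cast_nonneg m), ENNReal.ofReal_natCast,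
          ENNReal.ofReal_mul (p := r⁻¹ ^ 2) (by positivity)]

/-- This uniformity in `η` keeps the centres of the small balls in a fixed compact set. -/
lemma SmallJumpMoment.exists_norm_truncDrift_le (h : SmallJumpMoment Pi) :
    ∃ B : ℝ, ∀ η, ‖truncDrift Pi η‖ ≤ B := by
  refine ⟨(∫⁻ u in {u : Space m | ‖u‖ ≤ 1}, ENNReal.ofReal ‖u‖ ∂Pi).toReal, fun η => ?_⟩
  rw [truncDrift, norm_neg]
  refine (norm_integral_le_lintegral_norm _).trans (ENNReal.toReal_mono h.ne ?_)
  refine lintegral_mono_set fun u hu => ?_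
  simpa using hu.1

end Index

/-! ### Mass of shrinking balls against integrability of the density. -/

section Main

variable {m : ℕ} {Pi : Measure (Space m)} {Ω : Type*} [MeasurableSpace Ω] {P : Measure Ω}
  [IsProbabilityMeasure P] {U X : ℝ≥0 → Ω → Space m} {a : Space m → Space m} {x : Space m}

lemma tendsto_rpow_mul_log {s : ℝ} (hs : 0 < s) :
    Tendsto (fun ε : ℝ => ε ^ s * Real.log (1 / ε)) (𝓝[>] 0) (𝓝 0) := by
  have h := (tendsto_log_mul_rpow_nhdsGT_zero hs).neg
  rw [neg_zero] at h
  refine h.congr fun ε => ?_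
  rw [one_div, Real.log_inv]; ring

/-- For a level `T` above the lower order index, small balls of radius `ε ^ κ` are charged by the law
of the solution with mass at least `ε ^ α / 2`, along a sequence `ε → 0+`. -/
theorem IsSolution.frequently_smallBall (hX : IsSolution a x U X P) (hU : IsLevyProcess Pi U P)
    (hPi : IsLevyMeasure Pi) (ha : SmoothBoundedDerivatives a) {t : ℝ≥0} (ht : 0 < t) {α κ : ℝ}
    (hα : (t : ℝ≥0∞) * lowerOrderIndex Pi < ENNReal.ofReal α) (hκ0 : 0 < κ) (hκ1 : κ < 1) :
    ∃ C R : ℝ, 0 < C ∧ ∃ᶠ ε in 𝓝[>] (0 : ℝ), ∃ y : Space m, (SmallJumpMoment Pi → ‖y‖ ≤ R) ∧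
      ENNReal.ofReal (ε ^ α / 2) ≤ P.map (X t) (Metric.closedBall y (C * ε ^ κ)) := by
  obtain ⟨L, hL, haL⟩ := ha.exists_lipschitz
  have ht' : (0 : ℝ) < t := ht
  have hα0 : 0 < α := by
    by_contra hneg
    rw [ENNReal.ofReal_of_nonpos (not_lt.1 hneg)] at hα
    exact not_lt_zero hα
  -- a level `T` between the index and `α / t`
  obtain ⟨T, hT0, hTα, hTidx⟩ : ∃ T : ℝ, 0 < T ∧ t * T < α ∧
      lowerOrderIndex Pi < ENNReal.ofReal T := by
    have h1 : lowerOrderIndex Pi < ENNReal.ofReal (α / t) := by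
      rw [ENNReal.ofReal_div_of_pos ht', ENNReal.ofReal_coe_nnreal,
        ENNReal.lt_div_iff_mul_lt (Or.inl (by simpa using ht.ne')) (Or.inl ENNReal.coe_ne_top),
        mul_comm]
      exact hα
    obtain ⟨T, hT1, hT2⟩ := ENNReal.lt_iff_exists_nnreal_btwn.1 h1
    have hT3 : (T : ℝ) < α / t := by
      rw [← ENNReal.ofReal_coe_nnreal] at hT2
      exact (ENNReal.ofReal_lt_ofReal_iff (by positivity)).1 hT2
    refine ⟨T, ?_, ?_, by rwa [ENNReal.ofReal_coe_nnreal]⟩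
    · have : 0 < (T : ℝ≥0∞) := (zero_le).trans_lt hT1
      exact_mod_cast this
    · rw [lt_div_iff₀ ht'] at hT3; linarith
  -- With this `δ`, `1 - δ = t * T / α`, so the averaging loss turns `t * T` into exactly `α` in the
  -- exponent.
  have hδ : 0 < 1 - t * T / α := by rw [sub_pos, div_lt_one hα0]; exact hTα
  obtain ⟨r, hr, hr1, hslab⟩ := exists_slab_small (m := m) hδ
  obtain ⟨R, hR⟩ : ∃ R : ℝ, ∀ η ρ : ℝ, ρ ≤ 1 → SmallJumpMoment Pi →
      (‖x‖ + t * ‖a 0‖ + (ρ + t * ‖truncDrift Pi η‖)) * Real.exp (L * t) ≤ R := by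
    by_cases hs : SmallJumpMoment Pi
    · obtain ⟨B, hB⟩ := hs.exists_norm_truncDrift_le
      exact ⟨(‖x‖ + t * ‖a 0‖ + (1 + t * B)) * Real.exp (L * t), fun η ρ hρ _ => by
        have := hB η
        gcongr⟩
    · exact ⟨0, fun _ _ _ h => absurd h hs⟩
  refine ⟨2 * Real.exp (L * t), R, by positivity, ?_⟩
  have hfreq : ∃ᶠ ε in 𝓝[>] (0 : ℝ), lowerOrderFun Pi ε < ENNReal.ofReal T :=
    frequently_lt_of_liminf_lt (by isBoundedDefault) hTidx
  have hid : Tendsto (fun ε : ℝ => ε) (𝓝[>] 0) (𝓝 0) := tendsto_id.mono_left nhdsWithin_le_nhds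
  have hev1 : ∀ᶠ ε in 𝓝[>] (0 : ℝ), 0 < ε := eventually_mem_nhdsWithin
  have hev2 : ∀ᶠ ε in 𝓝[>] (0 : ℝ), ε < r := hid.eventually_lt_const hr
  -- The variance divided by `ρ² = ε ^ (2 * κ)` vanishes as `κ < 1`; below `1 / 2`, it leaves the
  -- factor `1 / 2` in the conclusion.
  have hev3 : ∀ᶠ ε in 𝓝[>] (0 : ℝ),
      t * (m * (r⁻¹ ^ 2 * T)) * (ε ^ (2 - 2 * κ) * Real.log (1 / ε)) < 1 / 2 := by
    have h1 := (tendsto_rpow_mul_log (s := 2 - 2 * κ) (by linarith)).const_mul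
      (t * (m * (r⁻¹ ^ 2 * T)))
    rw [mul_zero] at h1
    exact h1.eventually_lt_const (by norm_num)
  refine (hfreq.and_eventually (hev1.and (hev2.and hev3))).mono ?_
  rintro ε ⟨hεT, hε, hεr, hε3⟩
  have hε1 : ε < 1 := hεr.trans_le hr1
  have hlog : 0 < Real.log (1 / ε) := Real.log_pos (by rw [lt_div_iff₀ hε]; linarith)
  have hη : 0 < ε / r := by positivity
  have hη1 : ε / r ≤ 1 := by rw [div_le_one hr]; exact hεr.le
  have hρ : 0 < ε ^ κ := Real.rpow_pos_of_pos hε κ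
  obtain ⟨y, hy, hPy⟩ := hX.exists_smallBall hU hPi hL haL ht hη hη1 hρ
  refine ⟨y, fun hs => hy.trans (hR _ _ (Real.rpow_le_one hε.le hε1.le hκ0.le) hs), ?_⟩
  rw [mul_right_comm] at hPy
  refine le_trans ?_ hPy
  rw [← ENNReal.ofReal_mul (by positivity)]
  refine ENNReal.ofReal_le_ofReal ?_
  rw [div_eq_mul_one_div]
  refine mul_le_mul ?_ ?_ (by norm_num) (by positivity)
  · -- no large jumps
    have h1 := hPi.tail_le hδ hr hslab hε fun v hv =>
      measure_gt_le_of_lowerOrderFun_le hε hε1 hT0.le hεT.le hv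
    rw [sub_sub_cancel, ← ofReal_measureReal (h := (hPi.measure_lt_top hη).ne),
      ← ENNReal.ofReal_mul (by positivity), ENNReal.ofReal_le_ofReal_iff (by positivity)] at h1
    have h2 : t * Pi.real {u | ε / r < ‖u‖} ≤ α * Real.log (1 / ε) := by
      have h3 : t * T / α * Pi.real {u | ε / r < ‖u‖} =
          (t * Pi.real {u | ε / r < ‖u‖}) / α * T := by ring
      rw [h3, mul_comm T] at h1
      have h4 := le_of_mul_le_mul_right h1 hT0
      rw [div_le_iff₀ hα0] at h4
      linarith
    rw [Real.rpow_def_of_pos hε]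
    refine Real.exp_le_exp.2 ?_
    rw [one_div, Real.log_inv] at h2
    linarith
  · -- small variance
    have h1 := integral_sq_le_of_lowerOrderFun_le hε hε1 hT0.le hεT.le hr hr1
    have h2 : t * (∫ u in Metric.closedBall 0 (ε / r), ‖u‖ ^ 2 ∂Pi) / (ε ^ κ) ^ 2 ≤
        t * (m * (r⁻¹ ^ 2 * T)) * (ε ^ (2 - 2 * κ) * Real.log (1 / ε)) := by
      rw [div_le_iff₀ (by positivity)]
      calc t * (∫ u in Metric.closedBall 0 (ε / r), ‖u‖ ^ 2 ∂Pi)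
          ≤ t * (m * (r⁻¹ ^ 2 * (T * (ε ^ 2 * Real.log (1 / ε))))) := by gcongr
        _ = t * (m * (r⁻¹ ^ 2 * T)) * (ε ^ (2 - 2 * κ) * Real.log (1 / ε)) * (ε ^ κ) ^ 2 := by
          have h3 : ε ^ 2 = ε ^ (2 - 2 * κ) * (ε ^ κ) ^ 2 := by
            rw [← Real.rpow_natCast (ε ^ κ) 2, ← Real.rpow_mul hε.le, ← Real.rpow_add hε,
              ← Real.rpow_natCast ε 2]
            congr 1
            push_cast
            ring
          rw [h3]; ring
    linarith

/-- Hölder's inequality on the ball. At `q = ∞` the convention `∞.toReal = 0` gives `1 / 0 = 0`,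
hence the correct exponent `1`. -/
lemma IsDensity.measure_closedBall_le {μ : Measure (Space m)} {p : Space m → ℝ}
    (hp : IsDensity μ p) {q : ℝ≥0∞} (hq : 1 ≤ q) {S : Set (Space m)} {y : Space m} {r : ℝ}
    (hr : 0 ≤ r) (hS : Metric.closedBall y r ⊆ S) :
    μ (Metric.closedBall y r) ≤ eLpNorm p q (volume.restrict S) *
      (ENNReal.ofReal (r ^ m) * volume (Metric.closedBall (0 : Space m) 1)) ^
        (1 - 1 / q.toReal) := by
  have h1 : μ (Metric.closedBall y r) = eLpNorm p 1 (volume.restrict (Metric.closedBall y r)) := by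
    rw [hp.eq_withDensity, withDensity_apply _ measurableSet_closedBall, eLpNorm_one_eq_lintegral_enorm]
    exact lintegral_congr fun z => (Real.enorm_of_nonneg (hp.nonneg z)).symm
  have h2 := eLpNorm_le_eLpNorm_mul_rpow_measure_univ hq
    (hp.measurable.aestronglyMeasurable (μ := volume.restrict (Metric.closedBall y r)))
  rw [h1]
  refine h2.trans ?_
  rw [Measure.restrict_apply_univ, Measure.addHaar_closedBall _ _ hr,
    Measure.addHaar_closedBall (μ := volume) (0 : Space m) zero_le_one]
  simp only [one_pow, ENNReal.ofReal_one, one_mul, ENNReal.toReal_one, div_one, finrank_euclideanSpace,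
    Fintype.card_fin]
  gcongr

/-- The law of the solution has no density in `L_q` near the centres of the small balls. -/
theorem IsSolution.not_memLp (hX : IsSolution a x U X P) (hU : IsLevyProcess Pi U P)
    (hPi : IsLevyMeasure Pi) (ha : SmoothBoundedDerivatives a) {t : ℝ≥0} (ht : 0 < t)
    {p : Space m → ℝ} (hp : IsDensity (P.map (X t)) p) {q : ℝ≥0∞} (hq : 1 ≤ q)
    (hidx : (t : ℝ≥0∞) * lowerOrderIndex Pi < ENNReal.ofReal (m * (1 - 1 / q.toReal))) :
    (SmallJumpMoment Pi → ¬ MemLpLoc p q) ∧ ¬ MemLp p q volume := by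
  set β : ℝ := 1 - 1 / q.toReal with hβ
  obtain ⟨α', hα1, hα2⟩ := ENNReal.lt_iff_exists_nnreal_btwn.1 hidx
  set α : ℝ := NNReal.toReal α' with hα
  rw [← ENNReal.ofReal_coe_nnreal (p := α')] at hα1 hα2
  have hα0 : 0 ≤ α := α'.coe_nonneg
  have hmβ : 0 < m * β := by
    by_contra hneg
    rw [ENNReal.ofReal_of_nonpos (not_lt.1 hneg)] at hidx
    exact not_lt_zero hidx
  have hβ0 : 0 < β := pos_of_mul_pos_right hmβ (Nat.cast_nonneg m)
  have hαβ : α < m * β := (ENNReal.ofReal_lt_ofReal_iff hmβ).1 hα2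
  -- `κ < 1` is needed for the variance, `κ * (m * β) > α` for the contradiction with Hölder.
  obtain ⟨κ, hκα, hκ1⟩ := exists_between ((div_lt_one hmβ).2 hαβ)
  have hκ0 : 0 < κ := (div_nonneg hα0 hmβ.le).trans_lt hκα
  rw [div_lt_iff₀ hmβ] at hκα
  obtain ⟨C, R, hC, hfreq⟩ := hX.frequently_smallBall hU hPi ha ht hα1 hκ0 hκ1
  -- a finite norm on a set that contains the small balls is impossible
  have key : ∀ S : Set (Space m), (∀ ε : ℝ, 0 < ε → ε < 1 → ∀ y : Space m,
      (SmallJumpMoment Pi → ‖y‖ ≤ R) → Metric.closedBall y (C * ε ^ κ) ⊆ S) →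
      ¬ MemLp p q (volume.restrict S) := by
    intro S hS hmem
    set N := (eLpNorm p q (volume.restrict S)).toReal with hN
    set V := (volume (Metric.closedBall (0 : Space m) 1)).toReal with hV
    have hNe : eLpNorm p q (volume.restrict S) = ENNReal.ofReal N :=
      (ENNReal.ofReal_toReal hmem.2.ne).symm
    have hVe : volume (Metric.closedBall (0 : Space m) 1) = ENNReal.ofReal V :=
      (ENNReal.ofReal_toReal measure_closedBall_lt_top.ne).symm
    have hV0 : 0 ≤ V := ENNReal.toReal_nonneg
    have hN0 : 0 ≤ N := ENNReal.toReal_nonneg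
    have hlim : Tendsto (fun ε : ℝ => N * (C ^ m * V) ^ β * ε ^ (κ * (m * β) - α)) (𝓝[>] 0)
        (𝓝 0) := by
      have h1 : Tendsto (fun ε : ℝ => ε ^ (κ * (m * β) - α)) (𝓝[>] 0) (𝓝 0) := by
        have h2 := (Real.continuousAt_rpow_const 0 (κ * (m * β) - α)
          (Or.inr (by linarith))).tendsto.mono_left (nhdsWithin_le_nhds (s := Ioi (0 : ℝ)))
        rwa [Real.zero_rpow (by linarith)] at h2
      simpa using h1.const_mul (N * (C ^ m * V) ^ β)
    have hev := hlim.eventually_lt_const (show (0 : ℝ) < 1 / 2 by norm_num)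
    have hid : Tendsto (fun ε : ℝ => ε) (𝓝[>] 0) (𝓝 0) := tendsto_id.mono_left nhdsWithin_le_nhds
    have hev1 : ∀ᶠ ε in 𝓝[>] (0 : ℝ), 0 < ε := eventually_mem_nhdsWithin
    obtain ⟨ε, ⟨y, hyR, hy⟩, hlt, hε, hε1⟩ := (hfreq.and_eventually (hev.and (hev1.and
      (hid.eventually_lt_const one_pos)))).exists
    have hball := hp.measure_closedBall_le hq (r := C * ε ^ κ) (by positivity) (hS ε hε hε1 y hyR)
    have h3 := hy.trans hball
    rw [hNe, hVe, ← ENNReal.ofReal_mul (by positivity), ENNReal.ofReal_rpow_of_nonneg (by positivity)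
      hβ0.le, ← ENNReal.ofReal_mul hN0, ENNReal.ofReal_le_ofReal_iff (by positivity)] at h3
    have h4 : ((C * ε ^ κ) ^ m * V) ^ β = (C ^ m * V) ^ β * (ε ^ (κ * (m * β) - α) * ε ^ α) := by
      rw [← Real.rpow_add hε, sub_add_cancel, mul_pow, mul_right_comm,
        Real.mul_rpow (by positivity) (by positivity), ← Real.rpow_natCast (ε ^ κ) m,
        ← Real.rpow_mul hε.le, ← Real.rpow_mul hε.le]
      ring_nf
    rw [h4] at h3
    have h5 : 0 < ε ^ α := Real.rpow_pos_of_pos hε α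
    have h6 := mul_lt_mul_of_pos_right hlt h5
    linarith
  refine ⟨fun hs hloc => ?_, fun hmem => ?_⟩
  · refine key (Metric.closedBall 0 (R + C)) (fun ε hε hε1 y hy => ?_)
      (hloc _ (isCompact_closedBall _ _))
    refine Metric.closedBall_subset_closedBall' ?_
    rw [dist_zero_right]
    have h1 : ε ^ κ ≤ 1 := Real.rpow_le_one hε.le hε1.le hκ0.le
    nlinarith [hy hs]
  · exact key univ (fun _ _ _ _ _ => subset_univ _) (by simpa using hmem)

end Main

end LevySDE

end

/-! ### The four assertions. -/

open LevySDE in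
theorem theorem1p4 {m : ℕ} (hm : 1 ≤ m)
    {Ω : Type*} [MeasurableSpace Ω] (P : Measure Ω) [IsProbabilityMeasure P]
    (Pi : Measure (Space m)) (hPi : IsLevyMeasure Pi) (hlarge : LargeJumpMoments Pi)
    (U : ℝ≥0 → Ω → Space m) (hU : IsLevyProcess Pi U P)
    (a : Space m → Space m) (ha : SmoothBoundedDerivatives a)
    (x : Space m) (X : ℝ≥0 → Ω → Space m) (hX : IsSolution a x U X P)
    (t : ℝ≥0) (ht : 0 < t) (p : Space m → ℝ) (hp : IsDensity (P.map (X t)) p) :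
    -- under the small-jump moment condition: not locally in `L_r`, no continuous version
    (SmallJumpMoment Pi →
      (∀ r : ℝ, 1 < r →
        (t : ℝ≥0∞) * lowerOrderIndex Pi < ENNReal.ofReal ((m : ℝ) * (1 - 1 / r)) →
        ¬ MemLpLoc p (ENNReal.ofReal r)) ∧
      ((t : ℝ≥0∞) * lowerOrderIndex Pi < (m : ℝ≥0∞) →
        ¬ ∃ g : Space m → ℝ, Continuous g ∧ p =ᵐ[volume] g)) ∧
    -- without it: not in `L_r`, not (essentially) bounded
    (∀ r : ℝ, 1 < r →
      (t : ℝ≥0∞) * lowerOrderIndex Pi < ENNReal.ofReal ((m : ℝ) * (1 - 1 / r)) →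
      ¬ MemLp p (ENNReal.ofReal r) volume) ∧
    ((t : ℝ≥0∞) * lowerOrderIndex Pi < (m : ℝ≥0∞) →
      ¬ MemLp p ∞ volume) := by
  have finite : ∀ r : ℝ, 1 < r →
      (t : ℝ≥0∞) * lowerOrderIndex Pi < ENNReal.ofReal ((m : ℝ) * (1 - 1 / r)) →
      (SmallJumpMoment Pi → ¬ MemLpLoc p (ENNReal.ofReal r)) ∧
        ¬ MemLp p (ENNReal.ofReal r) volume := fun r hr h =>
    hX.not_memLp hU hPi ha ht hp (by simpa using hr.le)
      (by rwa [ENNReal.toReal_ofReal (by linarith)])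
  have infinite : (t : ℝ≥0∞) * lowerOrderIndex Pi < (m : ℝ≥0∞) →
      (SmallJumpMoment Pi → ¬ MemLpLoc p ∞) ∧ ¬ MemLp p ∞ volume := fun h =>
    hX.not_memLp hU hPi ha ht hp le_top (by simpa using h)
  refine ⟨fun hs => ⟨fun r hr h => (finite r hr h).1 hs, ?_⟩, fun r hr h => (finite r hr h).2,
    fun h => (infinite h).2⟩
  rintro h ⟨g, hg, hpg⟩
  -- A continuous version is bounded on compacts, so it would put `p` in the local class with
  -- exponent `∞`.
  refine (infinite h).1 hs fun K hK => ?_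
  obtain ⟨M, hM⟩ := hK.exists_bound_of_continuousOn hg.continuousOn
  refine memLp_top_of_bound hp.measurable.aestronglyMeasurable M ?_
  filter_upwards [ae_restrict_of_ae hpg, ae_restrict_mem hK.measurableSet] with y hy hyK
  rw [hy]
  exact hM y hyK
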